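/- Conventions. Let $d\ge 0$ be an integer; points of $\mathbb R^{2d}$ are written $z=(x,\omega)$ with $x,\omega\in\mathbb R^d$, and $B_r(z)$ is the open Euclidean ball, $B_r=B_r(0)$. A set $\Lambda\subset\mathbb R^{2d}$ is *Delone* if it is uniformly discrete and relatively dense. Its $r$-*patches* are the sets $B_r(z)\cap\Lambda$ with $z\in\Lambda$. A Delone set $\Lambda$ is a *quasicrystal* if (FLC) for each $r>0$ there are only finitely many $r$-patches up to translation, and (UCF) for each $r>0$ and each $r$-patch $P$ of $\Lambda$ the limit $$\lim_{R\to\infty}\frac{\#\{v\in\mathbb R^{2d} : P-v\subset \Lambda\cap B_R(z)\}}{\mathrm{vol}(B_R)}$$ exists uniformly in $z\in\mathbb R^{2d}$ and does not depend on $z$. For Delone sets $\Lambda,\Lambda'$ let $R(\Lambda,\Lambda')$ be the supremum of all $r>0$ for which there is $z$ with $|z|<1/r$ and $B_r\cap(\Lambda-z)=\Lambda'\cap B_r$, and let $d(\Lambda,\Lambda')=\min\{1,1/R(\Lambda,\Lambda')\}$. The *hull* $\Omega_\Lambda$ is the closure of $\{\Lambda-z : z\in\mathbb R^{2d}\}$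 with respect to $d$ in the space of Delone sets. Let $\pi(x,\omega)f(t)=e^{2\pi i\omega\cdot t}f(t-x)$. Fix a non-zero $\varphi\in\mathcal S(\mathbb R^d)$ and put $V_\varphi f(z)=\langle f,\pi(z)\varphi\rangle$ for $f\in\mathcal S'(\mathbb R^d)$. For $1\le p\le\infty$ let $M^p(\mathbb R^d)=\{f\in\mathcal S'(\mathbb R^d) : V_\varphi f\in L^p(\mathbb R^{2d})\}$ with $\|f\|_{M^p}=\|V_\varphi f\|_{L^p}$. For $f\in M^p(\mathbb R^d)$ and $h\in M^1(\mathbb R^d)$ let $\langle f,h\rangle=\|\varphi\|_2^{-2}\int_{\mathbb R^{2d}}V_\varphi f(z)\overline{V_\varphi h(z)}\,dz$. For $g_1,\dots,g_N\in M^1(\mathbb R^d)$ and $T\subset\mathbb R^{2d}$, let $\mathcal G(g_1,\dots,g_N,T)$ be the family $(\pi(z)g_i)_{1\le i\le N,\ z\in T}$. It is a *multiwindow Gabor frame* for $L^2(\mathbb R^d)$ if there are $A,B>0$ with $A\|f\|_2^2\le\sum_{i}\sum_{z\in T}|\langle f,\pi(z)g_i\rangle|^2\le B\|f\|_2^2$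 for all $f\in L^2(\mathbb R^d)$, and an $M^p$-*frame* if there are $A,B>0$ with $A\|f\|_{M^p}\le\big\|(\langle f,\pi(z)g_i\rangle)_{i,z}\big\|_{\ell^p}\le B\|f\|_{M^p}$ for all $f\in M^p(\mathbb R^d)$. **Theorem.** Let $\Lambda\subset\mathbb R^{2d}$ be a quasicrystal. Then there are $g\in M^1(\mathbb R^d)$, $N\in\mathbb N$ and $z_1,\dots,z_N\in\mathbb R^{2d}$ such that, with $g_i=\pi(z_i)g$, for every $T\in\Omega_\Lambda$ the system $\mathcal G(g_1,\dots,g_N,T)$ is a multiwindow Gabor frame for $L^2(\mathbb R^d)$ and an $M^p$-frame for all $1\le p\le\infty$. -/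

import Mathlib

open MeasureTheory Set Filter Topology
open scoped ENNReal SchwartzMap InnerProductSpace Pointwise

noncomputable section

namespace GaborQC

/-! ### Point sets in Euclidean space -/

section PointSets

variable {V : Type*} [NormedAddCommGroup V] [InnerProductSpace ℝ V] [FiniteDimensional ℝ V]
  [MeasurableSpace V] [BorelSpace V]

/-- A set is Delone if it is uniformly discrete and relatively dense, that is, if it carries a
Mathlib `DeloneSet` structure (some packing radius and some covering radius). -/
def IsDelone (Λ : Set V) : Prop :=
  ∃ D : Delone.DeloneSet V, (D : Set V) = Λ

/-- The translate `Λ - z`. -/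
def shiftSet (Λ : Set V) (z : V) : Set V := (-z) +ᵥ Λ

/-- The `r`-patches of `Λ`: the sets `B_r(z) ∩ Λ` with `z ∈ Λ` (`B_r(z)` the open ball). -/
def patches (Λ : Set V) (r : ℝ) : Set (Set V) :=
  {P | ∃ z ∈ Λ, P = Metric.ball z r ∩ Λ}

/-- Finite local complexity: for each `r > 0` there are only finitely many `r`-patches
up to translation. -/
def HasFLC (Λ : Set V) : Prop :=
  ∀ r : ℝ, 0 < r → ∃ F : Set (Set V), F.Finite ∧
    ∀ P ∈ patches Λ r, ∃ Q ∈ F, ∃ t : V, P = shiftSet Q t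

/-- The number of times the patch `P` appears in the part of `Λ` lying in the region `A`: the
number of `z` such that `P - z ⊆ Λ ∩ A`. (For `P` nonempty, `Λ` Delone, and `A` bounded this set
of vectors is finite.) -/
def patchCount (Λ P A : Set V) : ℕ :=
  {z : V | shiftSet P z ⊆ Λ ∩ A}.ncard

/-- `P` has frequency `c` in `Λ`: the number of appearances of `P` in a ball of radius `r`, divided
by the volume of the ball, tends to `c` as `r → ∞`, uniformly in the centre of the ball. -/
def HasPatchFrequency (Λ P : Set V) (c : ℝ) : Prop :=
  TendstoUniformly
    (fun (r : ℝ) (z : V) =>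
      (patchCount Λ P (Metric.ball z r) : ℝ) / (volume (Metric.ball (0 : V) r)).toReal)
    (fun _ => c) atTop

/-- Uniform cluster frequencies: every patch of `Λ` has a frequency. -/
def HasUCF (Λ : Set V) : Prop :=
  ∀ r : ℝ, 0 < r → ∀ P ∈ patches Λ r, ∃ c : ℝ, HasPatchFrequency Λ P c

/-- A quasicrystal is a Delone set of finite local complexity with uniform cluster frequencies. -/
structure IsQuasicrystal (Λ : Set V) : Prop where
  delone : IsDelone Λ
  flc : HasFLC Λ
  ucf : HasUCF Λ

/-- `R(Λ, Λ')`, the supremum in `[0, ∞]` of all `r > 0` such that for some `z` with `‖z‖ < 1 / r`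
the sets `Λ - z` and `Λ'` agree on the open ball `B_r` about the origin. -/
def agreementRadius (Λ Λ' : Set V) : ℝ≥0∞ :=
  sSup {ρ : ℝ≥0∞ | ∃ r : ℝ, 0 < r ∧ ρ = ENNReal.ofReal r ∧ ∃ z : V, ‖z‖ < 1 / r ∧
    Metric.ball 0 r ∩ shiftSet Λ z = Λ' ∩ Metric.ball 0 r}

/-- The distance `d(Λ, Λ') = min {1, 1 / R(Λ, Λ')}` (with `1 / 0 = ∞` and `1 / ∞ = 0`). -/
def patternDist (Λ Λ' : Set V) : ℝ≥0∞ := min 1 (agreementRadius Λ Λ')⁻¹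

/-- The hull of `Λ`: the closure of the orbit `{Λ - z | z ∈ V}` in the space of Delone sets with
the distance `d`. -/
def hull (Λ : Set V) : Set (Set V) :=
  {T | IsDelone T ∧ ∀ ε : ℝ≥0∞, 0 < ε → ∃ z : V, patternDist (shiftSet Λ z) T < ε}

end PointSets

/-! ### Frames -/

/-- A family `e` in a Hilbert space is a frame if there are `A, B > 0` such that
`A ‖f‖² ≤ ∑ⱼ |⟨f, eⱼ⟩|² ≤ B ‖f‖²` for all `f`. -/
def IsFrame {H J : Type*} [NormedAddCommGroup H] [InnerProductSpace ℂ H] (e : J → H) : Prop :=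
  ∃ A B : ℝ, 0 < A ∧ 0 < B ∧ ∀ f : H,
    Summable (fun j => ‖⟪e j, f⟫_ℂ‖ ^ 2) ∧
    A * ‖f‖ ^ 2 ≤ ∑' j, ‖⟪e j, f⟫_ℂ‖ ^ 2 ∧ ∑' j, ‖⟪e j, f⟫_ℂ‖ ^ 2 ≤ B * ‖f‖ ^ 2

/-! ### Time-frequency analysis -/

/-- The space `ℝᵈ`. -/
abbrev Sp (d : ℕ) := EuclideanSpace ℝ (Fin d)

/-- The time-frequency space `ℝ²ᵈ = ℝᵈ × ℝᵈ` with its Euclidean norm. A point `z = (x, ω)` has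
components `x = z.fst` and `ω = z.snd`. -/
abbrev TF (d : ℕ) := WithLp 2 (Sp d × Sp d)

/-- The Hilbert space `L²(ℝᵈ)`. -/
abbrev L2 (d : ℕ) := Lp ℂ 2 (volume : Measure (Sp d))

variable {d : ℕ}

/-- The character `t ↦ e^{2 π i ω · t}`. -/
def tfChar (ω t : Sp d) : ℂ := Complex.exp (2 * Real.pi * Complex.I * (⟪ω, t⟫_ℝ : ℝ))

theorem norm_tfChar (ω t : Sp d) : ‖tfChar ω t‖ = 1 := by
  have h : (2 * Real.pi * Complex.I * (⟪ω, t⟫_ℝ : ℝ) : ℂ)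
      = ((2 * Real.pi * ⟪ω, t⟫_ℝ : ℝ) : ℂ) * Complex.I := by
    push_cast; ring
  rw [tfChar, h, Complex.norm_exp_ofReal_mul_I]

theorem continuous_tfChar (ω : Sp d) : Continuous (tfChar ω) := by
  unfold tfChar
  fun_prop

theorem hasTemperateGrowth_tfChar (ω : Sp d) : (tfChar ω).HasTemperateGrowth := by
  have he : Function.HasTemperateGrowth
      (fun s : ℝ => Complex.exp (2 * Real.pi * Complex.I * (s : ℂ))) := by
    refine ⟨(contDiff_const.mul Complex.ofRealCLM.contDiff).cexp, fun n => ⟨0, (2 * Real.pi) ^ n, fun s => ?_⟩⟩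
    have hd : ∀ n : ℕ, iteratedDeriv n
        (fun s : ℝ => Complex.exp (2 * Real.pi * Complex.I * (s : ℂ)))
        = fun s : ℝ => (2 * Real.pi * Complex.I) ^ n *
            Complex.exp (2 * Real.pi * Complex.I * (s : ℂ)) := by
      intro n
      induction n with
      | zero => ext s; simp
      | succ k ih =>
        rw [iteratedDeriv_succ, ih]
        ext s
        have h1 : HasDerivAt (fun s : ℝ => (2 * Real.pi * Complex.I * (s : ℂ)))
            (2 * Real.pi * Complex.I) s := by
          simpa using (Complex.ofRealCLM.hasDerivAt (x := s)).const_mul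
            (2 * Real.pi * Complex.I : ℂ)
        rw [(h1.cexp.const_mul ((2 * Real.pi * Complex.I : ℂ) ^ k)).deriv]
        ring
    rw [norm_iteratedFDeriv_eq_norm_iteratedDeriv, hd]
    have h2 : (2 * Real.pi * Complex.I * (s : ℂ)) = ((2 * Real.pi * s : ℝ) : ℂ) * Complex.I := by
      push_cast; ring
    rw [norm_mul, h2, Complex.norm_exp_ofReal_mul_I]
    simp [abs_of_pos Real.pi_pos]
  exact he.comp (Function.hasTemperateGrowth_inner_right ω)

/-- The time-frequency shift `π(x, ω) f (t) = e^{2 π i ω · t} f (t - x)` of a function. -/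
def shiftFun (z : TF d) (f : Sp d → ℂ) : Sp d → ℂ :=
  fun t => tfChar z.snd t * f (t - z.fst)

theorem memLp_shiftFun (z : TF d) {f : Sp d → ℂ} (hf : MemLp f 2 volume) :
    MemLp (shiftFun z f) 2 volume := by
  have h1 : MemLp (fun t => f (t - z.fst)) 2 volume :=
    hf.comp_measurePreserving (measurePreserving_sub_right volume z.fst)
  refine h1.of_le ((continuous_tfChar z.snd).aestronglyMeasurable.mul h1.1) ?_
  filter_upwards with t
  simp [shiftFun, norm_tfChar]

/-- The time-frequency shift `π(z)` on `L²(ℝᵈ)`. -/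
def shiftL2 (z : TF d) (f : L2 d) : L2 d :=
  (memLp_shiftFun z (Lp.memLp f)).toLp (shiftFun z f)

/-- The time-frequency shift `π(z)` on Schwartz functions. -/
def shiftSchwartz (z : TF d) (φ : 𝓢(Sp d, ℂ)) : 𝓢(Sp d, ℂ) :=
  SchwartzMap.smulLeftCLM ℂ (tfChar z.snd) (SchwartzMap.compSubConstCLM ℂ z.fst φ)

theorem shiftSchwartz_apply (z : TF d) (φ : 𝓢(Sp d, ℂ)) (t : Sp d) :
    shiftSchwartz z φ t = shiftFun z φ t := by
  simp [shiftSchwartz, shiftFun,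
    SchwartzMap.smulLeftCLM_apply_apply (hasTemperateGrowth_tfChar z.snd)]

/-- The complex conjugate of a Schwartz function. -/
def conjSchwartz (φ : 𝓢(Sp d, ℂ)) : 𝓢(Sp d, ℂ) :=
  SchwartzMap.postcompCLM (𝕜 := ℝ) (Complex.conjCLE : ℂ →L[ℝ] ℂ) φ

theorem conjSchwartz_apply (φ : 𝓢(Sp d, ℂ)) (t : Sp d) :
    conjSchwartz φ t = starRingEnd ℂ (φ t) := rfl

/-- The short-time Fourier transform `V_φ f (z) = ⟨f, π(z) φ⟩` of a tempered distribution `f` with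
Schwartz window `φ`: the distribution `f` is applied to the conjugate of `π(z) φ`. -/
def stft (φ : 𝓢(Sp d, ℂ)) (f : 𝓢'(Sp d, ℂ)) (z : TF d) : ℂ :=
  f (conjSchwartz (shiftSchwartz z φ))

/-- For `f ∈ L²`, viewed as a tempered distribution, the short-time Fourier transform is the usual
integral `∫ f(t) conj(φ(t - x)) e^{- 2 π i ω · t} dt`. -/
theorem stft_L2 (φ : 𝓢(Sp d, ℂ)) (f : L2 d) (z : TF d) :
    stft φ (f : 𝓢'(Sp d, ℂ)) z =
      ∫ t, f t * starRingEnd ℂ (φ (t - z.fst)) *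
        Complex.exp (-(2 * Real.pi * Complex.I * (⟪z.snd, t⟫_ℝ : ℝ))) := by
  rw [stft, Lp.toTemperedDistribution_apply]
  refine integral_congr_ae (Eventually.of_forall fun t => ?_)
  simp only [conjSchwartz_apply, shiftSchwartz_apply, shiftFun, tfChar, map_mul, ← Complex.exp_conj,
    smul_eq_mul, Complex.conj_ofReal, Complex.conj_I, map_ofNat]
  rw [show (2 * (Real.pi : ℂ) * -Complex.I * (⟪z.snd, t⟫_ℝ : ℝ)) =
    -(2 * Real.pi * Complex.I * (⟪z.snd, t⟫_ℝ : ℝ)) by ring]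
  ring

/-- Membership in the modulation space `Mᵖ(ℝᵈ)` (defined by the Schwartz window `φ ≠ 0`):
`V_φ f ∈ Lᵖ(ℝ²ᵈ)`. -/
def MemM (φ : 𝓢(Sp d, ℂ)) (p : ℝ≥0∞) (f : 𝓢'(Sp d, ℂ)) : Prop :=
  MemLp (stft φ f) p volume

/-- The norm `‖f‖_{Mᵖ} = ‖V_φ f‖_{Lᵖ}` of an element of `Mᵖ(ℝᵈ)`. -/
def normM (φ : 𝓢(Sp d, ℂ)) (p : ℝ≥0∞) (f : 𝓢'(Sp d, ℂ)) : ℝ :=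
  (eLpNorm (stft φ f) p volume).toReal

/-- The duality pairing `⟨f, g⟩ = ‖φ‖₂⁻² ∫ V_φ f(z) conj(V_φ g(z)) dz` of `f ∈ Mᵖ(ℝᵈ)` with
`g ∈ M¹(ℝᵈ)`, conjugate-linear in `g`. It extends the inner product of `L²(ℝᵈ)` and the action of
tempered distributions on Schwartz functions; the integral converges absolutely
since `V_φ f ∈ L^∞` and `V_φ g ∈ L¹`. -/
def pairM (φ : 𝓢(Sp d, ℂ)) (f g : 𝓢'(Sp d, ℂ)) : ℂ :=
  ((∫ t, ‖φ t‖ ^ 2 : ℝ) : ℂ)⁻¹ * ∫ z : TF d, stft φ f z * starRingEnd ℂ (stft φ g z)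

/-- The multiwindow Gabor system `G(g₁, …, g_N, T)`: the family `π(z) gᵢ` indexed by
`i = 1, …, N` and `z ∈ T`. -/
def gaborSystem {N : ℕ} (g : Fin N → L2 d) (T : Set (TF d)) : Fin N × T → L2 d :=
  fun j => shiftL2 (j.2 : TF d) (g j.1)

/-- The family `e` (of elements of `M¹(ℝᵈ)`) is an `Mᵖ`-frame: the analysis operator
`f ↦ (⟨f, eⱼ⟩)ⱼ` maps `Mᵖ(ℝᵈ)` boundedly into `ℓᵖ` and is bounded below. -/
def IsMFrame {J : Type*} (φ : 𝓢(Sp d, ℂ)) (p : ℝ≥0∞) (e : J → L2 d) : Prop :=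
  ∃ A B : ℝ, 0 < A ∧ 0 < B ∧ ∀ f : 𝓢'(Sp d, ℂ), MemM φ p f →
    ∃ c : lp (fun _ : J => ℂ) p, (∀ j, c j = pairM φ f (e j : 𝓢'(Sp d, ℂ))) ∧
      A * normM φ p f ≤ ‖c‖ ∧ ‖c‖ ≤ B * normM φ p f

end GaborQC

end

/-
The idea. The difference of `V_φ f(z + u)` and `V_φ f(z)` is, up to a phase, `f` tested against
`π(z)(π(u)φ - φ)`. By the reproducing formula it is bounded by the convolution of `|V_φ f|` with
`|V_φ(π(u)φ - φ)|`, and for small `u` all these functions lie below one kernel of integral at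
most `1/2`. Young's inequality absorbs such a convolution in every `Lᵖ` at once, so that sampling
`V_φ f` on any `ε`-dense set of points with boundedly overlapping balls gives a norm equivalent to
`‖f‖_{Mᵖ}`, for all `1 ≤ p ≤ ∞`. Every set in the hull of `Λ` inherits the covering radius of `Λ`,
so the same finitely many translates make each of them `ε`-dense. Moyal's identity turns the
`M²`-frame into a frame of `L²`.
-/

noncomputable section

open FourierTransform
open scoped NNReal

namespace GaborQC

section Hull

variable {V : Type*} [NormedAddCommGroup V]

theorem mem_shiftSet {Λ : Set V} {v x : V} : x ∈ shiftSet Λ v ↔ x + v ∈ Λ := by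
  rw [shiftSet, mem_vadd_set_iff_neg_vadd_mem, neg_neg, vadd_eq_add, add_comm]

theorem exists_ball_inter_shiftSet_eq {Λ T : Set V} (hT : T ∈ hull Λ) (s : ℝ) :
    ∃ v, Metric.ball 0 s ∩ shiftSet Λ v = T ∩ Metric.ball 0 s := by
  obtain ⟨v, hv⟩ := hT.2 (ENNReal.ofReal (max s 1))⁻¹ (by simp)
  have hlt : ENNReal.ofReal (max s 1) < agreementRadius (shiftSet Λ v) T := by
    rcases min_lt_iff.mp hv with h | h
    · exact absurd h (by simp)
    · exact ENNReal.inv_lt_inv.mp h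
  obtain ⟨_, ⟨r, hr, rfl, y, -, hy⟩, hsr⟩ := lt_sSup_iff.mp hlt
  have hsub : Metric.ball (0 : V) s ⊆ Metric.ball 0 r := Metric.ball_subset_ball <|
    (le_max_left s 1).trans ((ENNReal.ofReal_lt_ofReal_iff hr).mp hsr).le
  refine ⟨y + v, Set.ext fun x => ?_⟩
  have hx := Set.ext_iff.mp hy x
  simp only [mem_inter_iff, mem_shiftSet, ← add_assoc] at hx ⊢
  have := @hsub x
  tauto

theorem isCover_of_mem_hull {Λ T : Set V} {ρ : ℝ≥0} (hΛ : Metric.IsCover ρ univ Λ)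
    (hT : T ∈ hull Λ) : Metric.IsCover ρ univ T := by
  refine .of_subset_iUnion_closedBall fun z _ => ?_
  obtain ⟨v, hv⟩ := exists_ball_inter_shiftSet_eq hT (‖z‖ + ρ + 1)
  obtain ⟨x, hx, hzx⟩ := mem_iUnion₂.mp (hΛ.subset_iUnion_closedBall (mem_univ (z + v)))
  have hdist : dist z (x - v) ≤ ρ := by rwa [dist_sub_eq_dist_add_right]
  have hmem : x - v ∈ Metric.ball 0 (‖z‖ + ρ + 1) ∩ shiftSet Λ v := by
    rw [mem_inter_iff, mem_shiftSet, sub_add_cancel, mem_ball_zero_iff]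
    refine ⟨?_, hx⟩
    linarith [norm_le_norm_add_norm_sub' (x - v) z, dist_comm z (x - v), dist_eq_norm (x - v) z]
  exact mem_iUnion₂.mpr ⟨x - v, (hv ▸ hmem).1, hdist⟩

theorem exists_finite_translates_dense [ProperSpace V] (ρ : ℝ≥0) {ε : ℝ} (hε : 0 < ε) :
    ∃ (N : ℕ) (ζ : Fin N → V), ∀ T : Set V, Metric.IsCover ρ univ T →
      ∀ z, ∃ j : Fin N × T, dist z (j.2 + ζ j.1) < ε := by
  obtain ⟨s, -, hs, hcov⟩ :=
    Metric.finite_approx_of_totallyBounded (isCompact_closedBall (0 : V) ρ).totallyBounded ε hε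
  obtain ⟨N, ζ, -, rfl⟩ := hs.fin_param
  refine ⟨N, ζ, fun T hT z => ?_⟩
  obtain ⟨t, ht, hzt⟩ := mem_iUnion₂.mp (hT.subset_iUnion_closedBall (mem_univ z))
  have hmem : z - t ∈ Metric.closedBall (0 : V) ρ := by
    rwa [mem_closedBall_zero_iff, ← dist_eq_norm]
  obtain ⟨_, ⟨i, rfl⟩, hi⟩ := mem_iUnion₂.mp (hcov hmem)
  exact ⟨(i, ⟨t, ht⟩), by rwa [add_comm, ← dist_sub_eq_dist_add_left]⟩

end Hull

section DeloneTranslates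

variable {V : Type*} [NormedAddCommGroup V]

theorem countable_of_isDelone [SecondCountableTopology V] {T : Set V} (hT : IsDelone T) :
    T.Countable := by
  obtain ⟨D, rfl⟩ := hT
  obtain ⟨r, hr, hD⟩ := D.subset_ball_singleton
  refine PairwiseDisjoint.countable_of_isOpen (s := fun t => Metric.ball t r)
    (fun s hs t ht hst => Set.disjoint_left.mpr fun z hzs hzt => hst ?_)
    (fun _ _ => Metric.isOpen_ball) fun _ _ => Metric.nonempty_ball.mpr (by exact_mod_cast hr)
  exact hD hs ht (Metric.mem_ball_comm.mp hzs) (Metric.mem_ball_comm.mp hzt)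

theorem exists_encard_mem_ball_add_le {T : Set V} (hT : IsDelone T) :
    ∃ r : ℝ, 0 < r ∧ ∀ {N : ℕ} (ζ : Fin N → V) (z : V),
      {j : Fin N × T | z ∈ Metric.ball (j.2 + ζ j.1) r}.encard ≤ N := by
  obtain ⟨D, rfl⟩ := hT
  obtain ⟨r, hr, hD⟩ := D.subset_ball_singleton
  refine ⟨r, by exact_mod_cast hr, fun {N} ζ z => ?_⟩
  have hinj : InjOn Prod.fst
      {j : Fin N × (D : Set V) | z ∈ Metric.ball (j.2 + ζ j.1 : V) r} := by
    rintro ⟨i, s, hs⟩ hsz ⟨_, t, ht⟩ htz rfl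
    have hball : ∀ x : V, z ∈ Metric.ball (x + ζ i) r → x ∈ Metric.ball (z - ζ i) r := by
      intro x hx
      rwa [Metric.mem_ball, dist_sub_eq_dist_add_right, dist_comm]
    exact Prod.ext rfl (Subtype.ext (hD hs ht (hball s hsz) (hball t htz)))
  calc _ ≤ (univ : Set (Fin N)).encard := encard_le_encard_of_injOn (fun _ _ => mem_univ _) hinj
    _ = N := by simp

end DeloneTranslates

section Young

variable {G : Type*} [AddCommGroup G] [MeasurableSpace G] [MeasurableAdd₂ G] [MeasurableNeg G]
  {μ : Measure G} {k a : G → ℝ≥0∞}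

theorem lconvolution_rpow_le (hk : Measurable k) (ha : Measurable a) {p : ℝ} (hp : 1 ≤ p) (z : G) :
    (k ⋆ₗ[μ] a) z ^ p ≤ (∫⁻ y, k y ∂μ) ^ (p - 1) * (k ⋆ₗ[μ] fun w => a w ^ p) z := by
  have hp0 : 0 < p := by linarith
  have hlint : ∀ g : G → ℝ≥0∞, Measurable g →
      ∫⁻ y, g (-y + z) ∂μ.withDensity k = (k ⋆ₗ[μ] g) z := fun g hg =>
    lintegral_withDensity_eq_lintegral_mul _ hk (by fun_prop)
  -- Jensen's inequality for the measure with density `k`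
  have hjensen := eLpNorm'_le_eLpNorm'_mul_rpow_measure_univ zero_lt_one hp
    (μ := μ.withDensity k) (f := fun y => a (-y + z))
    (Measurable.aestronglyMeasurable (by fun_prop))
  simp only [eLpNorm', enorm_eq_self, ENNReal.rpow_one, one_div_one,
    withDensity_apply _ MeasurableSet.univ, Measure.restrict_univ] at hjensen
  rw [hlint a ha, hlint (fun w => a w ^ p) (by fun_prop)] at hjensen
  calc (k ⋆ₗ[μ] a) z ^ p
      ≤ ((k ⋆ₗ[μ] fun w => a w ^ p) z ^ (1 / p) * (∫⁻ y, k y ∂μ) ^ (1 - 1 / p)) ^ p := by gcongr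
    _ = (∫⁻ y, k y ∂μ) ^ (p - 1) * (k ⋆ₗ[μ] fun w => a w ^ p) z := by
      rw [ENNReal.mul_rpow_of_nonneg _ _ hp0.le, ← ENNReal.rpow_mul, ← ENNReal.rpow_mul,
        one_div_mul_cancel hp0.ne', ENNReal.rpow_one, mul_comm, sub_mul, one_mul,
        one_div_mul_cancel hp0.ne']

variable [SFinite μ] [μ.IsAddLeftInvariant]

theorem lintegral_lconvolution (hk : Measurable k) (ha : Measurable a) :
    ∫⁻ z, (k ⋆ₗ[μ] a) z ∂μ = (∫⁻ y, k y ∂μ) * ∫⁻ z, a z ∂μ := by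
  simp only [lconvolution_def]
  rw [lintegral_lintegral_swap (by fun_prop), ← lintegral_mul_const _ hk]
  refine lintegral_congr fun y => ?_
  rw [lintegral_const_mul _ (by fun_prop), lintegral_add_left_eq_self]

theorem lconvolution_le_mul_essSup [μ.IsNegInvariant] (hk : Measurable k) (z : G) :
    (k ⋆ₗ[μ] a) z ≤ (∫⁻ y, k y ∂μ) * essSup a μ := by
  rw [← lintegral_mul_const _ hk]
  refine lintegral_mono_ae ?_
  filter_upwards [(quasiMeasurePreserving_sub_left μ z).ae (ENNReal.ae_le_essSup a)] with y hy
  rw [neg_add_eq_sub]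
  gcongr

theorem eLpNorm_lconvolution_le [μ.IsNegInvariant] (hk : Measurable k) (ha : Measurable a)
    {p : ℝ≥0∞} (hp : 1 ≤ p) :
    eLpNorm (k ⋆ₗ[μ] a) p μ ≤ (∫⁻ y, k y ∂μ) * eLpNorm a p μ := by
  by_cases htop : p = ∞
  · subst htop
    exact essSup_le_of_ae_le _ (Eventually.of_forall fun z => lconvolution_le_mul_essSup hk z)
  have hp0 : p ≠ 0 := (zero_lt_one.trans_le hp).ne'
  have hp1 : 1 ≤ p.toReal := ENNReal.toReal_one ▸ ENNReal.toReal_mono htop hp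
  have hP : 0 < p.toReal := zero_lt_one.trans_le hp1
  have hint : ∫⁻ z, (k ⋆ₗ[μ] a) z ^ p.toReal ∂μ
      ≤ (∫⁻ y, k y ∂μ) ^ p.toReal * ∫⁻ z, a z ^ p.toReal ∂μ := calc
    _ ≤ ∫⁻ z, (∫⁻ y, k y ∂μ) ^ (p.toReal - 1) * (k ⋆ₗ[μ] fun w => a w ^ p.toReal) z ∂μ :=
        lintegral_mono fun z => lconvolution_rpow_le hk ha hp1 z
    _ = _ := by
        rw [lintegral_const_mul _ (by fun_prop), lintegral_lconvolution hk (by fun_prop),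
          ← mul_assoc]
        nth_rewrite 2 [← ENNReal.rpow_one (∫⁻ y, k y ∂μ)]
        rw [← ENNReal.rpow_add_of_nonneg _ _ (by linarith) zero_le_one, sub_add_cancel]
  simp only [eLpNorm_eq_lintegral_rpow_enorm_toReal hp0 htop, enorm_eq_self]
  calc _ ≤ ((∫⁻ y, k y ∂μ) ^ p.toReal * ∫⁻ z, a z ^ p.toReal ∂μ) ^ (1 / p.toReal) := by gcongr
    _ = _ := by
      rw [ENNReal.mul_rpow_of_nonneg _ _ (by positivity), ← ENNReal.rpow_mul,
        mul_one_div_cancel hP.ne', ENNReal.rpow_one]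

end Young

section Sampling

variable {V : Type*} [NormedAddCommGroup V] [MeasurableSpace V] {μ : Measure V} {ε : ℝ}

/-- The oscillation of `a` at scale `ε` is dominated by the convolution of `a` with the kernel `k`:
`|a z' - a z| ≤ (k ⋆ a) z` whenever `dist z' z < ε`. -/
def OscBound (μ : Measure V) (k : V → ℝ≥0∞) (ε : ℝ) (a : V → ℝ≥0∞) : Prop :=
  ∀ z z', dist z' z < ε → a z ≤ a z' + (k ⋆ₗ[μ] a) z ∧ a z' ≤ a z + (k ⋆ₗ[μ] a) z

theorem OscBound.mono {k a : V → ℝ≥0∞} {ε' : ℝ} (h : OscBound μ k ε a) (hε : ε' ≤ ε) :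
    OscBound μ k ε' a :=
  fun z z' hz => h z z' (hz.trans_le hε)

theorem le_two_mul_of_le_add_half {x y κ : ℝ≥0∞} (hx : x ≠ ∞) (hκ : κ ≤ 2⁻¹)
    (h : x ≤ y + κ * x) : x ≤ 2 * y := by
  have hhalf : 2⁻¹ * x + 2⁻¹ * x ≤ y + 2⁻¹ * x := calc
    _ = x := by rw [← add_mul, ENNReal.inv_two_add_inv_two, one_mul]
    _ ≤ _ := h.trans (by gcongr)
  rw [mul_comm, ← ENNReal.div_le_iff two_ne_zero ENNReal.ofNat_ne_top, ENNReal.div_eq_inv_mul]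
  exact (ENNReal.add_le_add_iff_right (ENNReal.mul_ne_top (by simp) hx)).mp hhalf

variable [BorelSpace V] [μ.IsAddHaarMeasure] {J : Type*} [Countable J] {l : J → V}

theorem lintegral_tsum_ball_indicator (c : J → ℝ≥0∞) :
    ∫⁻ z, ∑' j, (Metric.ball (l j) ε).indicator (fun _ => c j) z ∂μ =
      μ (Metric.ball 0 ε) * ∑' j, c j := by
  rw [lintegral_tsum fun j =>
    (measurable_const.indicator Metric.isOpen_ball.measurableSet).aemeasurable,
    ← ENNReal.tsum_mul_left]
  refine tsum_congr fun j => ?_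
  rw [lintegral_indicator_const Metric.isOpen_ball.measurableSet, μ.addHaar_ball_center, mul_comm]

variable [MeasurableSpace J] [MeasurableSingletonClass J] {p : ℝ≥0∞}

theorem eLpNorm_le_of_forall_exists_mem_ball {b : V → ℝ≥0∞} {s : J → ℝ≥0∞}
    (h : ∀ z, ∃ j, z ∈ Metric.ball (l j) ε ∧ b z ≤ s j) (hp : p ≠ 0) :
    eLpNorm b p μ ≤ μ (Metric.ball 0 ε) ^ (1 / p.toReal) * eLpNorm s p .count := by
  by_cases htop : p = ∞
  · subst htop
    simp only [eLpNorm_exponent_top, eLpNormEssSup_count, enorm_eq_self, ENNReal.toReal_top,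
      div_zero, ENNReal.rpow_zero, one_mul]
    refine essSup_le_of_ae_le _ (Eventually.of_forall fun z => ?_)
    obtain ⟨j, -, hj⟩ := h z
    exact hj.trans (le_iSup s j)
  have hpt : ∀ z, b z ^ p.toReal
      ≤ ∑' j, (Metric.ball (l j) ε).indicator (fun _ => s j ^ p.toReal) z := fun z => by
    obtain ⟨j, hz, hj⟩ := h z
    calc b z ^ p.toReal ≤ (Metric.ball (l j) ε).indicator (fun _ => s j ^ p.toReal) z := by
          rw [indicator_of_mem hz]; gcongr
      _ ≤ _ := ENNReal.le_tsum j
  simp only [eLpNorm_eq_lintegral_rpow_enorm_toReal hp htop, enorm_eq_self, lintegral_count]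
  rw [← ENNReal.mul_rpow_of_nonneg _ _ (by positivity), ← lintegral_tsum_ball_indicator]
  exact ENNReal.rpow_le_rpow (lintegral_mono hpt) (by positivity)

theorem le_eLpNorm_of_forall_mem_ball {b : V → ℝ≥0∞} {s : J → ℝ≥0∞} (hε : 0 < ε)
    {N : ℕ} (hN : ∀ z, {j | z ∈ Metric.ball (l j) ε}.encard ≤ N)
    (h : ∀ j, ∀ z ∈ Metric.ball (l j) ε, s j ≤ b z) (hp : p ≠ 0) :
    μ (Metric.ball 0 ε) ^ (1 / p.toReal) * eLpNorm s p .count ≤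
      (N : ℝ≥0∞) ^ (1 / p.toReal) * eLpNorm b p μ := by
  by_cases htop : p = ∞
  · subst htop
    simp only [eLpNorm_exponent_top, eLpNormEssSup_count, enorm_eq_self, ENNReal.toReal_top,
      div_zero, ENNReal.rpow_zero, one_mul]
    refine iSup_le fun j => ?_
    obtain ⟨z, hz, hbz⟩ : ∃ z ∈ Metric.ball (l j) ε, b z ≤ essSup b μ := by
      by_contra! hlt
      exact (Metric.measure_ball_pos μ (l j) hε).ne' <| measure_mono_null
        (fun z hz => not_le.mpr (hlt z hz)) (ENNReal.ae_le_essSup b)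
    exact (h j z hz).trans hbz
  have hpt : ∀ z, ∑' j, (Metric.ball (l j) ε).indicator (fun _ => s j ^ p.toReal) z
      ≤ N * b z ^ p.toReal := fun z => by
    calc _ ≤ ∑' j, {j | z ∈ Metric.ball (l j) ε}.indicator (fun _ => b z ^ p.toReal) j := by
          refine ENNReal.tsum_le_tsum fun j => ?_
          classical
          simp only [indicator_apply, mem_ofPred_eq]
          split_ifs with hz
          · gcongr
            exact h j z hz
          · rfl
      _ = {j | z ∈ Metric.ball (l j) ε}.encard * b z ^ p.toReal := by
          rw [← tsum_subtype, ENNReal.tsum_set_const]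
      _ ≤ _ := by
          gcongr
          exact_mod_cast hN z
  simp only [eLpNorm_eq_lintegral_rpow_enorm_toReal hp htop, enorm_eq_self, lintegral_count]
  rw [← ENNReal.mul_rpow_of_nonneg _ _ (by positivity),
    ← ENNReal.mul_rpow_of_nonneg _ _ (by positivity), ← lintegral_tsum_ball_indicator (l := l),
    ← lintegral_const_mul' _ _ (by simp)]
  gcongr
  exact hpt _

variable [NormedSpace ℝ V] [FiniteDimensional ℝ V] {k a : V → ℝ≥0∞}

theorem eLpNorm_le_eLpNorm_samples (hk : Measurable k) (hk2 : ∫⁻ y, k y ∂μ ≤ 2⁻¹)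
    (ha : Measurable a) (hosc : OscBound μ k ε a) (hl : ∀ z, ∃ j, dist z (l j) < ε) (hp : 1 ≤ p)
    (hfin : eLpNorm a p μ ≠ ∞) :
    eLpNorm a p μ ≤ 2 * μ (Metric.ball 0 ε) ^ (1 / p.toReal) * eLpNorm (a ∘ l) p .count := by
  have hdense : ∀ z, ∃ j, z ∈ Metric.ball (l j) ε ∧ (a - k ⋆ₗ[μ] a) z ≤ (a ∘ l) j := fun z => by
    obtain ⟨j, hj⟩ := hl z
    exact ⟨j, hj, tsub_le_iff_right.mpr (hosc z (l j) (by rwa [dist_comm])).1⟩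
  rw [mul_assoc]
  refine le_two_mul_of_le_add_half hfin hk2 ?_
  calc eLpNorm a p μ ≤ eLpNorm ((a - k ⋆ₗ[μ] a) + k ⋆ₗ[μ] a) p μ :=
        eLpNorm_mono_enorm fun z => le_tsub_add
    _ ≤ eLpNorm (a - k ⋆ₗ[μ] a) p μ + eLpNorm (k ⋆ₗ[μ] a) p μ :=
        eLpNorm_add_le (ha.sub (by fun_prop)).aestronglyMeasurable
          (measurable_lconvolution μ hk ha).aestronglyMeasurable hp
    _ ≤ _ := by
        gcongr
        · exact eLpNorm_le_of_forall_exists_mem_ball hdense (zero_lt_one.trans_le hp).ne'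
        · exact eLpNorm_lconvolution_le hk ha hp

theorem eLpNorm_samples_le_eLpNorm (hk : Measurable k) (hk2 : ∫⁻ y, k y ∂μ ≤ 2⁻¹)
    (ha : Measurable a) (hosc : OscBound μ k ε a) (hε : 0 < ε) {N : ℕ}
    (hN : ∀ z, {j | z ∈ Metric.ball (l j) ε}.encard ≤ N) (hp : 1 ≤ p) :
    eLpNorm (a ∘ l) p .count ≤
      (μ (Metric.ball 0 ε) ^ (1 / p.toReal))⁻¹ * (N ^ (1 / p.toReal) * 2) * eLpNorm a p μ := by
  have hball : ∀ j, ∀ z ∈ Metric.ball (l j) ε, (a ∘ l) j ≤ (a + k ⋆ₗ[μ] a) z := fun j z hz =>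
    (hosc z (l j) (by rwa [dist_comm])).2
  have hsum : eLpNorm (a + k ⋆ₗ[μ] a) p μ ≤ 2 * eLpNorm a p μ := calc
    _ ≤ eLpNorm a p μ + eLpNorm (k ⋆ₗ[μ] a) p μ :=
        eLpNorm_add_le ha.aestronglyMeasurable
          (measurable_lconvolution μ hk ha).aestronglyMeasurable hp
    _ ≤ eLpNorm a p μ + 1 * eLpNorm a p μ := by
        gcongr
        refine (eLpNorm_lconvolution_le hk ha hp).trans ?_
        gcongr
        exact hk2.trans (by simp)
    _ = _ := by rw [one_mul, two_mul]
  have hvol : μ (Metric.ball 0 ε) ^ (1 / p.toReal) ≠ 0 :=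
    (ENNReal.rpow_pos (Metric.measure_ball_pos _ _ hε) measure_ball_lt_top.ne).ne'
  have hvol' : μ (Metric.ball 0 ε) ^ (1 / p.toReal) ≠ ∞ :=
    ENNReal.rpow_ne_top_of_nonneg (by positivity) measure_ball_lt_top.ne
  rw [mul_assoc, ← ENNReal.div_eq_inv_mul, ENNReal.le_div_iff_mul_le (.inl hvol) (.inl hvol'),
    mul_comm, mul_assoc]
  calc _ ≤ (N : ℝ≥0∞) ^ (1 / p.toReal) * eLpNorm (a + k ⋆ₗ[μ] a) p μ :=
        le_eLpNorm_of_forall_mem_ball hε hN hball (zero_lt_one.trans_le hp).ne'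
    _ ≤ _ := by gcongr

end Sampling

section SequenceSpace

variable {J E : Type*} [MeasurableSpace J] [MeasurableSingletonClass J] [NormedAddCommGroup E]

theorem exists_lp_norm_eq_eLpNorm_count {p : ℝ≥0∞} (hp : 1 ≤ p) {c : J → E}
    (hc : eLpNorm c p .count ≠ ∞) :
    ∃ x : lp (fun _ : J => E) p, ⇑x = c ∧ ‖x‖ = (eLpNorm c p .count).toReal := by
  by_cases htop : p = ∞
  · subst htop
    rw [eLpNorm_exponent_top, eLpNormEssSup_count] at hc ⊢
    have hbdd : BddAbove (range fun j => ‖c j‖) := by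
      refine ⟨(⨆ j, ‖c j‖ₑ).toReal, forall_mem_range.mpr fun j => ?_⟩
      rw [← toReal_enorm]
      exact ENNReal.toReal_mono hc (le_iSup (fun j => ‖c j‖ₑ) j)
    refine ⟨⟨c, memℓp_infty hbdd⟩, rfl, ?_⟩
    rw [lp.norm_eq_ciSup, ENNReal.toReal_iSup fun j => enorm_ne_top]
    simp
  have hp0 : p ≠ 0 := (zero_lt_one.trans_le hp).ne'
  have hP : 0 < p.toReal := ENNReal.toReal_pos hp0 htop
  rw [eLpNorm_eq_lintegral_rpow_enorm_toReal hp0 htop, lintegral_count] at hc ⊢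
  have hsum : ∑' j, ‖c j‖ₑ ^ p.toReal ≠ ∞ := fun h =>
    hc (by rw [h, ENNReal.top_rpow_of_pos (by positivity)])
  have hterm : ∀ j, (‖c j‖ₑ ^ p.toReal).toReal = ‖c j‖ ^ p.toReal := fun j => by
    rw [← ENNReal.toReal_rpow, toReal_enorm]
  refine ⟨⟨c, memℓp_gen (by simpa only [hterm] using ENNReal.summable_toReal hsum)⟩, rfl, ?_⟩
  rw [lp.norm_eq_tsum_rpow hP, ← ENNReal.toReal_rpow,
    ENNReal.tsum_toReal_eq fun j => ENNReal.rpow_ne_top_of_nonneg hP.le enorm_ne_top]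
  simp only [hterm]

end SequenceSpace

section Translation

theorem one_add_norm_le_mul_sub {E : Type*} [SeminormedAddCommGroup E] (t x : E) :
    1 + ‖t‖ ≤ (1 + ‖x‖) * (1 + ‖t - x‖) := by
  have h : ‖t‖ ≤ ‖x‖ + ‖t - x‖ := by simpa using norm_add_le x (t - x)
  nlinarith [mul_nonneg (norm_nonneg x) (norm_nonneg (t - x))]

variable {E F : Type*} [NormedAddCommGroup E] [NormedSpace ℝ E] [NormedAddCommGroup F]
  [NormedSpace ℝ F]

theorem exists_seminorm_weighted_deriv_le (k n : ℕ) :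
    ∃ q : Seminorm ℝ 𝓢(E, F), Continuous q ∧ ∀ (φ : 𝓢(E, F)) (t : E),
      (1 + ‖t‖) ^ k * ‖iteratedFDeriv ℝ n φ t‖ ≤ q φ :=
  ⟨(2 ^ k : ℝ≥0) • (Finset.Iic (k, n)).sup (schwartzSeminormFamily ℝ E F),
    (Seminorm.continuous_finsetSup fun i _ =>
      (schwartz_withSeminorms ℝ E F).continuous_seminorm i).const_smul (2 ^ k : ℝ≥0),
    fun φ t => SchwartzMap.one_add_le_sup_seminorm_apply (𝕜 := ℝ) (m := (k, n)) le_rfl le_rfl φ t⟩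

theorem exists_norm_iteratedFDeriv_sub_le (φ : 𝓢(E, F)) (k n : ℕ) :
    ∃ C, ∀ t x : E, ‖x‖ ≤ 1 →
      (1 + ‖t‖) ^ k * ‖iteratedFDeriv ℝ n φ (t - x) - iteratedFDeriv ℝ n φ t‖ ≤ C * ‖x‖ := by
  obtain ⟨r, -, hr⟩ := exists_seminorm_weighted_deriv_le (E := E) (F := F) k (n + 1)
  refine ⟨2 ^ k * r φ, fun t x hx => ?_⟩
  have hderiv : ∀ s ∈ segment ℝ t (t - x),
      ‖fderiv ℝ (iteratedFDeriv ℝ n φ) s‖ ≤ 2 ^ k * r φ / (1 + ‖t‖) ^ k := by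
    intro s hs
    have hts : ‖t - s‖ ≤ 1 := by
      simpa [norm_sub_rev] using (norm_sub_le_of_mem_segment hs).trans (by simpa using hx)
    have hweight : 1 + ‖t‖ ≤ 2 * (1 + ‖s‖) := by
      nlinarith [one_add_norm_le_mul_sub t s, norm_nonneg s]
    rw [norm_fderiv_iteratedFDeriv, le_div_iff₀ (by positivity)]
    calc ‖iteratedFDeriv ℝ (n + 1) φ s‖ * (1 + ‖t‖) ^ k
        ≤ ‖iteratedFDeriv ℝ (n + 1) φ s‖ * (2 * (1 + ‖s‖)) ^ k := by gcongr
      _ = 2 ^ k * ((1 + ‖s‖) ^ k * ‖iteratedFDeriv ℝ (n + 1) φ s‖) := by rw [mul_pow]; ring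
      _ ≤ 2 ^ k * r φ := by gcongr; exact hr φ s
  have hmv := (convex_segment t (t - x)).norm_image_sub_le_of_norm_fderiv_le (𝕜 := ℝ)
    (fun s _ => (φ.smooth (n + 1 : ℕ)).differentiable_iteratedFDeriv
      (by exact_mod_cast n.lt_succ_self) s)
    hderiv (left_mem_segment ℝ _ _) (right_mem_segment ℝ _ _)
  rw [sub_sub_cancel_left, norm_neg] at hmv
  calc _ ≤ (1 + ‖t‖) ^ k * (2 ^ k * r φ / (1 + ‖t‖) ^ k * ‖x‖) := by gcongr
    _ = 2 ^ k * r φ * ‖x‖ := by field_simp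

variable (𝕜 : Type*) [RCLike 𝕜] [NormedSpace 𝕜 F]

theorem iteratedFDeriv_translate (φ : 𝓢(E, F)) (n : ℕ) (x t : E) :
    iteratedFDeriv ℝ n (SchwartzMap.compSubConstCLM 𝕜 x φ) t = iteratedFDeriv ℝ n φ (t - x) := by
  have h : (SchwartzMap.compSubConstCLM 𝕜 x φ : E → F) = fun s => φ (s - x) := by
    ext s
    exact SchwartzMap.compSubConstCLM_apply _ _ _
  rw [h, iteratedFDeriv_comp_sub]

theorem exists_seminorm_translate_le (q : Seminorm ℝ 𝓢(E, F)) (hq : Continuous q) :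
    ∃ (k : ℕ) (q' : Seminorm ℝ 𝓢(E, F)), Continuous q' ∧ ∀ (x : E) (φ : 𝓢(E, F)),
      q (SchwartzMap.compSubConstCLM 𝕜 x φ) ≤ (1 + ‖x‖) ^ k * q' φ := by
  obtain ⟨s, C, -, hC⟩ := Seminorm.bound_of_continuous (schwartz_withSeminorms ℝ E F) q hq
  choose r hr hrle using
    fun i : ℕ × ℕ => exists_seminorm_weighted_deriv_le (E := E) (F := F) i.1 i.2
  refine ⟨s.sup Prod.fst, C • s.sup r,
    (Seminorm.continuous_finsetSup fun i _ => hr i).const_smul C, fun x φ => ?_⟩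
  have hsup : s.sup (schwartzSeminormFamily ℝ E F) (SchwartzMap.compSubConstCLM 𝕜 x φ) ≤
      (1 + ‖x‖) ^ s.sup Prod.fst * s.sup r φ := by
    refine Seminorm.finset_sup_apply_le (by positivity) fun i hi => ?_
    refine SchwartzMap.seminorm_le_bound ℝ i.1 i.2 _ (by positivity) fun t => ?_
    rw [iteratedFDeriv_translate]
    calc ‖t‖ ^ i.1 * ‖iteratedFDeriv ℝ i.2 φ (t - x)‖
        ≤ ((1 + ‖x‖) * (1 + ‖t - x‖)) ^ i.1 * ‖iteratedFDeriv ℝ i.2 φ (t - x)‖ := by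
          gcongr
          linarith [one_add_norm_le_mul_sub t x]
      _ = (1 + ‖x‖) ^ i.1 * ((1 + ‖t - x‖) ^ i.1 * ‖iteratedFDeriv ℝ i.2 φ (t - x)‖) := by
          rw [mul_pow, mul_assoc]
      _ ≤ (1 + ‖x‖) ^ i.1 * r i φ := by
          gcongr
          exact hrle i φ _
      _ ≤ (1 + ‖x‖) ^ s.sup Prod.fst * s.sup r φ := by
          gcongr
          · linarith [norm_nonneg x]
          · exact Finset.le_sup (f := Prod.fst) hi
          · exact Seminorm.le_finset_sup_apply hi
  calc q (SchwartzMap.compSubConstCLM 𝕜 x φ)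
      ≤ C * s.sup (schwartzSeminormFamily ℝ E F) (SchwartzMap.compSubConstCLM 𝕜 x φ) := hC _
    _ ≤ C * ((1 + ‖x‖) ^ s.sup Prod.fst * s.sup r φ) := by gcongr
    _ = (1 + ‖x‖) ^ s.sup Prod.fst * (C * s.sup r φ) := by ring

theorem tendsto_translate_nhds_zero (φ : 𝓢(E, F)) :
    Tendsto (fun x : E => SchwartzMap.compSubConstCLM 𝕜 x φ) (𝓝 0) (𝓝 φ) := by
  rw [(schwartz_withSeminorms ℝ E F).tendsto_nhds]
  rintro ⟨k, n⟩ ε hε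
  obtain ⟨C, hC⟩ := exists_norm_iteratedFDeriv_sub_le φ k n
  have hbound : ∀ x : E, ‖x‖ ≤ 1 →
      schwartzSeminormFamily ℝ E F (k, n) (SchwartzMap.compSubConstCLM 𝕜 x φ - φ) ≤
        C * ‖x‖ := by
    intro x hx
    have hsub (t : E) : iteratedFDeriv ℝ n (SchwartzMap.compSubConstCLM 𝕜 x φ - φ : 𝓢(E, F)) t =
        iteratedFDeriv ℝ n φ (t - x) - iteratedFDeriv ℝ n φ t := by
      rw [← iteratedFDeriv_translate 𝕜]
      exact iteratedFDeriv_sub_apply (SchwartzMap.smooth _ n).contDiffAt (φ.smooth n).contDiffAt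
    have hle (t : E) : ‖t‖ ^ k *
        ‖iteratedFDeriv ℝ n (SchwartzMap.compSubConstCLM 𝕜 x φ - φ : 𝓢(E, F)) t‖ ≤ C * ‖x‖ := by
      rw [hsub]
      refine le_trans ?_ (hC t x hx)
      gcongr
      linarith
    exact SchwartzMap.seminorm_le_bound ℝ k n _
      ((by positivity : (0 : ℝ) ≤ _).trans (hle 0)) hle
  have hlim : Tendsto (fun x : E => C * ‖x‖) (𝓝 0) (𝓝 0) := by
    simpa using (continuous_norm.const_mul C).tendsto (0 : E)
  filter_upwards [hlim.eventually (gt_mem_nhds hε), Metric.ball_mem_nhds (0 : E) one_pos]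
    with x hx hx1
  exact (hbound x (mem_ball_zero_iff.mp hx1).le).trans_lt hx

theorem continuous_translate (φ : 𝓢(E, F)) :
    Continuous fun x : E => SchwartzMap.compSubConstCLM 𝕜 x φ := by
  rw [continuous_iff_continuousAt]
  intro x₀
  have hcomp : (fun x : E => SchwartzMap.compSubConstCLM 𝕜 x φ) =
      fun x => SchwartzMap.compSubConstCLM 𝕜 x₀ (SchwartzMap.compSubConstCLM 𝕜 (x - x₀) φ) := by
    funext x
    rw [SchwartzMap.compSubConstCLM_comp, sub_add_cancel]
  rw [ContinuousAt, hcomp]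
  have h0 : Tendsto (fun x : E => x - x₀) (𝓝 x₀) (𝓝 0) := by
    simpa using (continuous_sub_right x₀).tendsto x₀
  exact ((SchwartzMap.compSubConstCLM 𝕜 x₀).continuous.tendsto _).comp
    ((tendsto_translate_nhds_zero 𝕜 φ).comp h0)

end Translation

section Modulation

variable {d : ℕ}

theorem tfChar_add_left (ω η t : Sp d) : tfChar (ω + η) t = tfChar ω t * tfChar η t := by
  rw [tfChar, tfChar, tfChar, ← Complex.exp_add, inner_add_left]
  congr 1
  push_cast
  ring

theorem tfChar_comm (ω t : Sp d) : tfChar ω t = tfChar t ω := by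
  rw [tfChar, tfChar, real_inner_comm]

theorem tfChar_add_right (ω t s : Sp d) : tfChar ω (t + s) = tfChar ω t * tfChar ω s := by
  rw [tfChar_comm, tfChar_add_left, tfChar_comm t, tfChar_comm s]

theorem tfChar_neg_right (ω t : Sp d) : tfChar ω (-t) = tfChar (-ω) t := by
  rw [tfChar, tfChar, inner_neg_left, inner_neg_right]

theorem conj_tfChar (ω t : Sp d) : starRingEnd ℂ (tfChar ω t) = tfChar (-ω) t := by
  rw [tfChar, tfChar, ← Complex.exp_conj, inner_neg_left]
  simp [map_ofNat]

theorem fourier_eq_integral_tfChar (φ : 𝓢(Sp d, ℂ)) (ω : Sp d) :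
    𝓕 φ ω = ∫ t, tfChar (-ω) t * φ t := by
  rw [SchwartzMap.fourier_coe, Real.fourier_eq']
  refine integral_congr_ae (Eventually.of_forall fun t => ?_)
  simp only [tfChar, smul_eq_mul, inner_neg_left, real_inner_comm]
  congr 2
  push_cast
  ring

theorem fourier_modulate (ω : Sp d) (φ : 𝓢(Sp d, ℂ)) :
    𝓕 (SchwartzMap.smulLeftCLM ℂ (tfChar ω) φ) = SchwartzMap.compSubConstCLM ℂ ω (𝓕 φ) := by
  ext η
  rw [SchwartzMap.compSubConstCLM_apply, fourier_eq_integral_tfChar, fourier_eq_integral_tfChar]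
  refine integral_congr_ae (Eventually.of_forall fun t => ?_)
  simp only [SchwartzMap.smulLeftCLM_apply_apply (hasTemperateGrowth_tfChar ω), smul_eq_mul]
  rw [← mul_assoc, ← tfChar_add_left, neg_sub, sub_eq_neg_add]

theorem fourier_translate (x : Sp d) (φ : 𝓢(Sp d, ℂ)) :
    𝓕 (SchwartzMap.compSubConstCLM ℂ x φ) = SchwartzMap.smulLeftCLM ℂ (tfChar (-x)) (𝓕 φ) := by
  ext η
  rw [SchwartzMap.smulLeftCLM_apply_apply (hasTemperateGrowth_tfChar _),
    fourier_eq_integral_tfChar, fourier_eq_integral_tfChar, smul_eq_mul, ← integral_const_mul,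
    ← integral_sub_right_eq_self (fun t => tfChar (-x) η * (tfChar (-η) t * φ t)) x]
  refine integral_congr_ae (Eventually.of_forall fun t => ?_)
  simp only [SchwartzMap.compSubConstCLM_apply]
  rw [tfChar_comm (-x), tfChar_neg_right, ← mul_assoc, ← tfChar_add_right, add_sub_cancel]

theorem modulate_eq (ω : Sp d) (φ : 𝓢(Sp d, ℂ)) :
    SchwartzMap.smulLeftCLM ℂ (tfChar ω) φ = 𝓕⁻ (SchwartzMap.compSubConstCLM ℂ ω (𝓕 φ)) := by
  rw [← fourier_modulate, fourierInv_fourier_eq]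

theorem exists_seminorm_modulate_le (q : Seminorm ℝ 𝓢(Sp d, ℂ)) (hq : Continuous q) :
    ∃ (k : ℕ) (q' : Seminorm ℝ 𝓢(Sp d, ℂ)), Continuous q' ∧ ∀ (ω : Sp d) (φ : 𝓢(Sp d, ℂ)),
      q (SchwartzMap.smulLeftCLM ℂ (tfChar ω) φ) ≤ (1 + ‖ω‖) ^ k * q' φ := by
  obtain ⟨k, q', hq', h⟩ := exists_seminorm_translate_le ℂ
    (q.comp (fourierInvCLM ℝ 𝓢(Sp d, ℂ)).toLinearMap)
    (hq.comp (fourierInvCLM ℝ 𝓢(Sp d, ℂ)).continuous)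
  refine ⟨k, q'.comp (fourierCLM ℝ 𝓢(Sp d, ℂ)).toLinearMap,
    hq'.comp (fourierCLM ℝ 𝓢(Sp d, ℂ)).continuous, fun ω φ => ?_⟩
  rw [modulate_eq]
  exact h ω (𝓕 φ)

theorem continuous_modulate (φ : 𝓢(Sp d, ℂ)) :
    Continuous fun ω : Sp d => SchwartzMap.smulLeftCLM ℂ (tfChar ω) φ := by
  simp_rw [modulate_eq]
  exact (fourierInvCLM ℂ 𝓢(Sp d, ℂ)).continuous.comp (continuous_translate ℂ (𝓕 φ))

end Modulation

section TimeFrequencyShift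

variable {d : ℕ}

theorem exists_seminorm_shift_le (q : Seminorm ℝ 𝓢(Sp d, ℂ)) (hq : Continuous q) :
    ∃ (k : ℕ) (q' : Seminorm ℝ 𝓢(Sp d, ℂ)), Continuous q' ∧ ∀ (w : TF d) (φ : 𝓢(Sp d, ℂ)),
      q (shiftSchwartz w φ) ≤ (1 + ‖w‖) ^ k * q' φ := by
  obtain ⟨k₁, q₁, hq₁, h₁⟩ := exists_seminorm_modulate_le q hq
  obtain ⟨k₂, q₂, hq₂, h₂⟩ := exists_seminorm_translate_le ℂ q₁ hq₁
  refine ⟨k₁ + k₂, q₂, hq₂, fun w φ => ?_⟩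
  calc q (shiftSchwartz w φ)
      ≤ (1 + ‖w.snd‖) ^ k₁ * q₁ (SchwartzMap.compSubConstCLM ℂ w.fst φ) := h₁ _ _
    _ ≤ (1 + ‖w.snd‖) ^ k₁ * ((1 + ‖w.fst‖) ^ k₂ * q₂ φ) := by gcongr; exact h₂ _ _
    _ ≤ (1 + ‖w‖) ^ k₁ * ((1 + ‖w‖) ^ k₂ * q₂ φ) := by
        gcongr
        · exact WithLp.norm_snd_le _ w
        · exact WithLp.norm_fst_le _ w
    _ = (1 + ‖w‖) ^ (k₁ + k₂) * q₂ φ := by ring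

theorem continuous_shiftSchwartz (φ : 𝓢(Sp d, ℂ)) :
    Continuous fun w : TF d => shiftSchwartz w φ := by
  rw [continuous_iff_continuousAt]
  intro w₀
  rw [ContinuousAt, (schwartz_withSeminorms ℝ (Sp d) ℂ).tendsto_nhds]
  intro i ε hε
  have hp : Continuous (schwartzSeminormFamily ℝ (Sp d) ℂ i) :=
    (schwartz_withSeminorms ℝ (Sp d) ℂ).continuous_seminorm i
  obtain ⟨k, q, hq, hmod⟩ := exists_seminorm_modulate_le _ hp
  let T (w : TF d) : 𝓢(Sp d, ℂ) := SchwartzMap.compSubConstCLM ℂ w.fst φ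
  let S (w : TF d) : 𝓢(Sp d, ℂ) := SchwartzMap.smulLeftCLM ℂ (tfChar w.snd) (T w₀)
  have hT : Continuous T := (continuous_translate ℂ φ).comp (WithLp.continuous_fst 2 _ _)
  have hS : Continuous S := (continuous_modulate (T w₀)).comp (WithLp.continuous_snd 2 _ _)
  have hsub (w : TF d) : shiftSchwartz w φ - shiftSchwartz w₀ φ =
      SchwartzMap.smulLeftCLM ℂ (tfChar w.snd) (T w - T w₀) + (S w - S w₀) := by
    rw [map_sub]
    simp [shiftSchwartz, T, S]
  have hcont : Continuous fun w : TF d => (1 + ‖w.snd‖) ^ k * q (T w - T w₀) +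
      schwartzSeminormFamily ℝ (Sp d) ℂ i (S w - S w₀) :=
    (((continuous_const.add (WithLp.continuous_snd 2 _ _).norm).pow k).mul
      (hq.comp (hT.sub continuous_const))).add (hp.comp (hS.sub continuous_const))
  have hlim := hcont.tendsto w₀
  simp only [sub_self, map_zero, mul_zero, add_zero] at hlim
  filter_upwards [hlim.eventually (gt_mem_nhds hε)] with w hw
  rw [hsub]
  exact ((map_add_le_add _ _ _).trans (add_le_add_left (hmod _ _) _)).trans_lt hw

theorem shiftFun_shiftFun (z u : TF d) (f : Sp d → ℂ) :
    shiftFun z (shiftFun u f) = fun t => tfChar (-u.snd) z.fst * shiftFun (z + u) f t := by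
  ext t
  simp only [shiftFun, WithLp.add_fst, WithLp.add_snd]
  rw [sub_sub, tfChar_add_left, sub_eq_add_neg t, tfChar_add_right, tfChar_neg_right]
  ring

theorem shiftSchwartz_shiftSchwartz (z u : TF d) (φ : 𝓢(Sp d, ℂ)) :
    shiftSchwartz z (shiftSchwartz u φ) =
      tfChar (-u.snd) z.fst • shiftSchwartz (z + u) φ := by
  ext t
  have h : (shiftSchwartz u φ : Sp d → ℂ) = shiftFun u φ := funext (shiftSchwartz_apply u φ)
  rw [shiftSchwartz_apply, h, shiftFun_shiftFun, smul_apply, shiftSchwartz_apply, smul_eq_mul]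

theorem norm_shiftSchwartz_apply (w : TF d) (φ : 𝓢(Sp d, ℂ)) (t : Sp d) :
    ‖shiftSchwartz w φ t‖ = ‖φ (t - w.fst)‖ := by
  rw [shiftSchwartz_apply, shiftFun, norm_mul, norm_tfChar, one_mul]

end TimeFrequencyShift

section Decay

theorem one_add_norm_pow_le_fst_add_snd {E F : Type*} [SeminormedAddCommGroup E]
    [SeminormedAddCommGroup F] (w : WithLp 2 (E × F)) (M : ℕ) :
    (1 + ‖w‖) ^ M ≤ 2 ^ (M - 1) * ((1 + ‖w.fst‖) ^ M + (1 + ‖w.snd‖) ^ M) := by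
  have hnorm : ‖w‖ ≤ ‖w.fst‖ + ‖w.snd‖ := by
    refine (abs_le_of_sq_le_sq' ?_ (by positivity)).2
    rw [WithLp.prod_norm_sq_eq_of_L2]
    nlinarith [mul_nonneg (norm_nonneg w.fst) (norm_nonneg w.snd)]
  calc (1 + ‖w‖) ^ M ≤ ((1 + ‖w.fst‖) + (1 + ‖w.snd‖)) ^ M :=
        pow_le_pow_left₀ (by positivity) (by linarith) M
    _ ≤ _ := add_pow_le (by positivity) (by positivity) M

variable {E F G : Type*} [NormedAddCommGroup E] [NormedSpace ℝ E] [NormedAddCommGroup F]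
  [NormedSpace ℝ F] [NormedAddCommGroup G] [NormedSpace ℝ G]

theorem exists_seminorm_mul_translate_le (φ : 𝓢(E, F)) (M n : ℕ) :
    ∃ q : Seminorm ℝ 𝓢(E, G), Continuous q ∧ ∀ (χ : 𝓢(E, G)) (x t : E),
      (1 + ‖x‖) ^ M * (‖χ t‖ * ‖φ (t - x)‖) ≤ q χ * ((1 + ‖t‖) ^ n)⁻¹ := by
  obtain ⟨q₁, -, h₁⟩ := exists_seminorm_weighted_deriv_le (E := E) (F := F) M 0
  obtain ⟨q₂, hq₂, h₂⟩ := exists_seminorm_weighted_deriv_le (E := E) (F := G) (M + n) 0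
  simp only [norm_iteratedFDeriv_zero] at h₁ h₂
  refine ⟨(q₁ φ).toNNReal • q₂, hq₂.const_smul _, fun χ x t => ?_⟩
  have hx : 1 + ‖x‖ ≤ (1 + ‖t‖) * (1 + ‖t - x‖) := by
    rw [norm_sub_rev]
    exact one_add_norm_le_mul_sub x t
  rw [← div_eq_mul_inv, le_div_iff₀ (by positivity)]
  calc (1 + ‖x‖) ^ M * (‖χ t‖ * ‖φ (t - x)‖) * (1 + ‖t‖) ^ n
      ≤ ((1 + ‖t‖) * (1 + ‖t - x‖)) ^ M * (‖χ t‖ * ‖φ (t - x)‖) * (1 + ‖t‖) ^ n := by gcongr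
    _ = ((1 + ‖t - x‖) ^ M * ‖φ (t - x)‖) * ((1 + ‖t‖) ^ (M + n) * ‖χ t‖) := by
        rw [mul_pow]
        ring
    _ ≤ q₁ φ * q₂ χ := by
        gcongr
        exacts [h₁ φ _, h₂ χ t]
    _ = ((q₁ φ).toNNReal • q₂) χ := by
        rw [smul_apply, NNReal.smul_def, Real.coe_toNNReal _ (by positivity), smul_eq_mul]

variable [FiniteDimensional ℝ E] [MeasurableSpace E] [BorelSpace E] (μ : Measure E)
  [μ.IsAddHaarMeasure]

theorem integrable_inv_one_add_norm_pow {n : ℕ} (hn : Module.finrank ℝ E < n) :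
    Integrable (fun t : E => ((1 + ‖t‖) ^ n)⁻¹) μ := by
  refine (integrable_one_add_norm (μ := μ) (Nat.cast_lt.mpr hn)).congr
    (Eventually.of_forall fun t => ?_)
  simp only [Real.rpow_neg (by positivity : 0 ≤ 1 + ‖t‖), Real.rpow_natCast]

theorem exists_seminorm_integral_mul_translate_le (φ : 𝓢(E, F)) (M : ℕ) :
    ∃ q : Seminorm ℝ 𝓢(E, G), Continuous q ∧ ∀ (χ : 𝓢(E, G)) (x : E),
      (1 + ‖x‖) ^ M * ∫ t, ‖χ t‖ * ‖φ (t - x)‖ ∂μ ≤ q χ := by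
  let n := Module.finrank ℝ E + 1
  obtain ⟨q, hq, hbound⟩ := exists_seminorm_mul_translate_le (G := G) φ M n
  have hI : 0 ≤ ∫ t : E, ((1 + ‖t‖) ^ n)⁻¹ ∂μ := integral_nonneg fun t => by positivity
  refine ⟨(∫ t : E, ((1 + ‖t‖) ^ n)⁻¹ ∂μ).toNNReal • q, hq.const_smul _, fun χ x => ?_⟩
  rw [← integral_const_mul]
  calc ∫ t, (1 + ‖x‖) ^ M * (‖χ t‖ * ‖φ (t - x)‖) ∂μ
      ≤ ∫ t, q χ * ((1 + ‖t‖) ^ n)⁻¹ ∂μ :=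
        integral_mono_of_nonneg (Eventually.of_forall fun t => by positivity)
          ((integrable_inv_one_add_norm_pow μ (Nat.lt_succ_self _)).const_mul _)
          (Eventually.of_forall fun t => hbound χ x t)
    _ = ((∫ t : E, ((1 + ‖t‖) ^ n)⁻¹ ∂μ).toNNReal • q) χ := by
        rw [integral_const_mul, smul_apply, NNReal.smul_def, Real.coe_toNNReal _ hI,
          smul_eq_mul, mul_comm]

end Decay

section SchwartzSTFT

variable {d : ℕ}

theorem stft_schwartz (φ χ : 𝓢(Sp d, ℂ)) (w : TF d) :
    stft φ χ w = ∫ t, χ t * starRingEnd ℂ (shiftSchwartz w φ t) := by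
  rw [stft, SchwartzMap.coe_apply]
  simp only [conjSchwartz_apply, smul_eq_mul, mul_comm]

theorem norm_stft_schwartz_le (φ χ : 𝓢(Sp d, ℂ)) (w : TF d) :
    ‖stft φ χ w‖ ≤ ∫ t, ‖χ t‖ * ‖φ (t - w.fst)‖ := by
  rw [stft_schwartz]
  refine (norm_integral_le_integral_norm _).trans (le_of_eq ?_)
  simp only [norm_mul, RCLike.norm_conj, norm_shiftSchwartz_apply]

theorem norm_stft_schwartz_le_fourier (φ χ : 𝓢(Sp d, ℂ)) (w : TF d) :
    ‖stft φ χ w‖ ≤ ∫ t, ‖(𝓕 χ) t‖ * ‖(𝓕 φ) (t - w.snd)‖ := by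
  have hparseval : stft φ χ w = ∫ t, (𝓕 χ) t * starRingEnd ℂ ((𝓕 (shiftSchwartz w φ)) t) := by
    simpa only [stft_schwartz, RCLike.inner_apply] using
      (SchwartzMap.integral_inner_fourier_fourier (shiftSchwartz w φ) χ).symm
  rw [hparseval]
  refine (norm_integral_le_integral_norm _).trans (le_of_eq ?_)
  refine integral_congr_ae (Eventually.of_forall fun t => ?_)
  simp only [norm_mul, RCLike.norm_conj]
  rw [shiftSchwartz, fourier_modulate, fourier_translate, SchwartzMap.compSubConstCLM_apply,
    SchwartzMap.smulLeftCLM_apply_apply (hasTemperateGrowth_tfChar _), norm_smul, norm_tfChar,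
    one_mul]

theorem exists_seminorm_stft_schwartz_decay (φ : 𝓢(Sp d, ℂ)) (M : ℕ) :
    ∃ q : Seminorm ℝ 𝓢(Sp d, ℂ), Continuous q ∧ ∀ (χ : 𝓢(Sp d, ℂ)) (w : TF d),
      (1 + ‖w‖) ^ M * ‖stft φ χ w‖ ≤ q χ := by
  obtain ⟨q₁, hq₁, h₁⟩ := exists_seminorm_integral_mul_translate_le (G := ℂ) volume φ M
  obtain ⟨q₂, hq₂, h₂⟩ := exists_seminorm_integral_mul_translate_le (G := ℂ) volume (𝓕 φ) M
  refine ⟨(2 ^ (M - 1) : ℝ≥0) • (q₁ + q₂.comp (fourierCLM ℝ 𝓢(Sp d, ℂ)).toLinearMap),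
    (hq₁.add (hq₂.comp (fourierCLM ℝ 𝓢(Sp d, ℂ)).continuous)).const_smul (2 ^ (M - 1) : ℝ≥0),
    fun χ w => ?_⟩
  calc (1 + ‖w‖) ^ M * ‖stft φ χ w‖
      ≤ 2 ^ (M - 1) * ((1 + ‖w.fst‖) ^ M + (1 + ‖w.snd‖) ^ M) * ‖stft φ χ w‖ := by
        gcongr
        exact one_add_norm_pow_le_fst_add_snd w M
    _ = 2 ^ (M - 1) *
          ((1 + ‖w.fst‖) ^ M * ‖stft φ χ w‖ + (1 + ‖w.snd‖) ^ M * ‖stft φ χ w‖) := by ring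
    _ ≤ 2 ^ (M - 1) * (q₁ χ + q₂ (𝓕 χ)) := by
        gcongr
        · exact le_trans (by gcongr; exact norm_stft_schwartz_le φ χ w) (h₁ χ w.fst)
        · exact le_trans (by gcongr; exact norm_stft_schwartz_le_fourier φ χ w) (h₂ (𝓕 χ) w.snd)

theorem norm_stft_schwartz_shift (φ h : 𝓢(Sp d, ℂ)) (z w : TF d) :
    ‖stft φ (shiftSchwartz z h) w‖ = ‖stft φ h (w - z)‖ := by
  have hcov : stft φ (shiftSchwartz z h) w =
      tfChar z.snd z.fst * starRingEnd ℂ (tfChar w.snd z.fst) * stft φ h (w - z) := by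
    rw [stft_schwartz, stft_schwartz, ← integral_add_right_eq_self _ z.fst, ← integral_const_mul]
    refine integral_congr_ae (Eventually.of_forall fun t => ?_)
    simp only [shiftSchwartz_apply, shiftFun, map_mul, WithLp.sub_fst, WithLp.sub_snd,
      conj_tfChar, neg_sub, add_sub_cancel_right]
    rw [show t + z.fst - w.fst = t - (w.fst - z.fst) by abel, sub_eq_add_neg z.snd w.snd]
    simp only [tfChar_add_left, tfChar_add_right]
    ring
  rw [hcov, norm_mul, norm_mul, RCLike.norm_conj, norm_tfChar, norm_tfChar, one_mul, one_mul]

end SchwartzSTFT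

section WeakIntegral

open scoped BoundedContinuousFunction

variable {𝕜 E F : Type*} [RCLike 𝕜] [NormedAddCommGroup E] [NormedSpace ℝ E]
  [NormedAddCommGroup F] [NormedSpace ℝ F] [NormedSpace 𝕜 F] [SMulCommClass ℝ 𝕜 F]

/-- The continuous `n`-linear maps `E [×n]→L[ℝ] F`, as a type synonym on which all instances come
from one norm; on the original type the normed structures of bounded functions fail to unify. -/
def MultForm (E F : Type*) [NormedAddCommGroup E] [NormedSpace ℝ E] [NormedAddCommGroup F]
    [NormedSpace ℝ F] (n : ℕ) : Type _ :=
  E [×n]→L[ℝ] F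

instance (n : ℕ) : NormedAddCommGroup (MultForm E F n) :=
  inferInstanceAs (NormedAddCommGroup (E [×n]→L[ℝ] F))

instance (n : ℕ) : NormedSpace ℝ (MultForm E F n) :=
  inferInstanceAs (NormedSpace ℝ (E [×n]→L[ℝ] F))

instance (n : ℕ) : NormedSpace 𝕜 (MultForm E F n) :=
  inferInstanceAs (NormedSpace 𝕜 (E [×n]→L[ℝ] F))

instance (n : ℕ) : SMulCommClass ℝ 𝕜 (MultForm E F n) :=
  inferInstanceAs (SMulCommClass ℝ 𝕜 (E [×n]→L[ℝ] F))

instance [CompleteSpace F] (n : ℕ) : CompleteSpace (MultForm E F n) :=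
  inferInstanceAs (CompleteSpace (E [×n]→L[ℝ] F))

/-- The `n`-th derivative of a Schwartz function, with values in `MultForm E F n`. -/
def formDeriv (n : ℕ) (φ : 𝓢(E, F)) (t : E) : MultForm E F n := iteratedFDeriv ℝ n φ t

theorem continuous_formDeriv (n : ℕ) (φ : 𝓢(E, F)) : Continuous (formDeriv n φ) :=
  (φ.smooth n).continuous_iteratedFDeriv le_rfl

variable (𝕜) in
/-- The weighted derivative `t ↦ ‖t‖ᵏ Dⁿφ(t)` of Schwartz functions `φ`, as a continuous linear map
into a Banach space whose norm induces the Schwartz seminorm of order `(k, n)`. -/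
def weightedDeriv (k n : ℕ) : 𝓢(E, F) →L[𝕜] E →ᵇ MultForm E F n :=
  SchwartzMap.mkCLMtoNormedSpace (σ := RingHom.id 𝕜)
    (fun φ : 𝓢(E, F) => BoundedContinuousFunction.ofNormedAddCommGroup
      (fun t : E => ‖t‖ ^ k • formDeriv n φ t)
      ((continuous_norm.pow k).smul (continuous_formDeriv n φ))
      (SchwartzMap.seminorm ℝ k n φ)
      (fun t => by
        rw [norm_smul, Real.norm_of_nonneg (by positivity)]
        exact SchwartzMap.le_seminorm ℝ k n φ t))
    (fun φ ψ => by
      ext1 t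
      exact (congr_arg (‖t‖ ^ k • ·) (iteratedFDeriv_add_apply (φ.smooth n).contDiffAt
        (ψ.smooth n).contDiffAt)).trans
        (smul_add (‖t‖ ^ k) (formDeriv n φ t) (formDeriv n ψ t)))
    (fun c φ => by
      ext1 t
      exact (congr_arg (‖t‖ ^ k • ·) (iteratedFDeriv_const_smul_apply
        (φ.smooth n).contDiffAt)).trans
        (smul_comm (‖t‖ ^ k) c (formDeriv n φ t)))
    ⟨{(k, n)}, 1, zero_le_one, fun φ => by
      rw [Finset.sup_singleton, one_mul]
      exact BoundedContinuousFunction.norm_ofNormedAddCommGroup_le _ (apply_nonneg _ _) _⟩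

theorem weightedDeriv_apply (k n : ℕ) (φ : 𝓢(E, F)) (t : E) :
    weightedDeriv 𝕜 k n φ t = ‖t‖ ^ k • formDeriv n φ t := rfl

theorem norm_weightedDeriv (k n : ℕ) (φ : 𝓢(E, F)) :
    ‖weightedDeriv 𝕜 k n φ‖ = SchwartzMap.seminorm 𝕜 k n φ := by
  have hnorm (t : E) : ‖weightedDeriv 𝕜 k n φ t‖ = ‖t‖ ^ k * ‖iteratedFDeriv ℝ n φ t‖ := by
    rw [weightedDeriv_apply, norm_smul, Real.norm_of_nonneg (by positivity)]
    rfl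
  refine le_antisymm ?_
    (SchwartzMap.seminorm_le_bound 𝕜 k n φ (norm_nonneg (weightedDeriv 𝕜 k n φ)) fun t => ?_)
  · exact (BoundedContinuousFunction.norm_le (apply_nonneg (SchwartzMap.seminorm 𝕜 k n) φ)).2
      fun t => (hnorm t).trans_le (SchwartzMap.le_seminorm 𝕜 k n φ t)
  · exact (hnorm t).symm.trans_le ((weightedDeriv 𝕜 k n φ).norm_coe_le_norm t)

theorem continuous_iteratedFDeriv_apply (n : ℕ) (t : E) :
    Continuous fun φ : 𝓢(E, F) => iteratedFDeriv ℝ n φ t := by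
  have heval : ∀ φ : 𝓢(E, F),
      BoundedContinuousFunction.evalCLM ℝ t (weightedDeriv ℝ 0 n φ) = iteratedFDeriv ℝ n φ t :=
    fun φ => by
      rw [BoundedContinuousFunction.evalCLM_apply, weightedDeriv_apply, pow_zero, one_smul]
      rfl
  exact ((BoundedContinuousFunction.evalCLM ℝ t).continuous.comp
    (weightedDeriv ℝ 0 n).continuous).congr heval

variable {W : Type*} [TopologicalSpace W] [MeasurableSpace W] [OpensMeasurableSpace W]
  [SecondCountableTopology W] {μ : Measure W} {G : W → 𝓢(E, F)}

theorem hasFDerivAt_integral_iteratedFDeriv (hG : Continuous G)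
    (hint : ∀ n, Integrable (fun w => SchwartzMap.seminorm ℝ 0 n (G w)) μ) (n : ℕ) (t : E) :
    HasFDerivAt (fun t => ∫ w, iteratedFDeriv ℝ n (G w) t ∂μ)
      (∫ w, fderiv ℝ (iteratedFDeriv ℝ n (G w)) t ∂μ) t := by
  have hmeas : ∀ n t, AEStronglyMeasurable (fun w => iteratedFDeriv ℝ n (G w) t) μ := fun n t =>
    ((continuous_iteratedFDeriv_apply n t).comp hG).aestronglyMeasurable
  have hbd : ∀ n w t, ‖iteratedFDeriv ℝ n (G w) t‖ ≤ SchwartzMap.seminorm ℝ 0 n (G w) :=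
    fun n w t => SchwartzMap.norm_iteratedFDeriv_le_seminorm ℝ (G w) n t
  have hmeas' : AEStronglyMeasurable (fun w => fderiv ℝ (iteratedFDeriv ℝ n (G w)) t) μ := by
    let L := continuousMultilinearCurryLeftEquiv ℝ (fun _ : Fin (n + 1) => E) F
    have hL : ∀ w, fderiv ℝ (iteratedFDeriv ℝ n (G w)) t = L (iteratedFDeriv ℝ (n + 1) (G w) t) :=
      fun w => by
        rw [iteratedFDeriv_succ_eq_comp_left, Function.comp_apply,
          LinearIsometryEquiv.apply_symm_apply]
    simp_rw [hL]
    exact L.continuous.comp_aestronglyMeasurable (hmeas (n + 1) t)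
  refine hasFDerivAt_integral_of_dominated_of_fderiv_le (𝕜 := ℝ) (s := univ)
    (F := fun s w => iteratedFDeriv ℝ n (G w) s)
    (F' := fun s w => fderiv ℝ (iteratedFDeriv ℝ n (G w)) s)
    (bound := fun w => SchwartzMap.seminorm ℝ 0 (n + 1) (G w)) univ_mem
    (Eventually.of_forall fun s => hmeas n s)
    ((hint n).mono' (hmeas n t) (Eventually.of_forall fun w => hbd n w t)) hmeas'
    (Eventually.of_forall fun w s _ => ?_) (hint (n + 1)) (Eventually.of_forall fun w s _ => ?_)
  · rw [norm_fderiv_iteratedFDeriv]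
    exact hbd (n + 1) w s
  · exact (((G w).smooth (n + 1 : ℕ)).differentiable_iteratedFDeriv
      (by exact_mod_cast n.lt_succ_self) s).hasFDerivAt

theorem iteratedFDeriv_integral (hG : Continuous G)
    (hint : ∀ n, Integrable (fun w => SchwartzMap.seminorm ℝ 0 n (G w)) μ) (n : ℕ) :
    iteratedFDeriv ℝ n (fun t => ∫ w, G w t ∂μ) = fun t => ∫ w, iteratedFDeriv ℝ n (G w) t ∂μ := by
  induction n with
  | zero =>
    ext1 t
    simp only [iteratedFDeriv_zero_eq_comp, Function.comp_apply]
    exact ((continuousMultilinearCurryFin0 ℝ E F).symm.toContinuousLinearEquiv.integral_comp_comm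
      (fun w => G w t)).symm
  | succ n ih =>
    ext1 t
    let L := continuousMultilinearCurryLeftEquiv ℝ (fun _ : Fin (n + 1) => E) F
    rw [iteratedFDeriv_succ_eq_comp_left, Function.comp_apply, ih,
      (hasFDerivAt_integral_iteratedFDeriv hG hint n t).fderiv]
    exact (ContinuousLinearEquiv.integral_comp_comm (𝕜 := ℝ) (E := E →L[ℝ] E [×n]→L[ℝ] F)
      (F := E [×(n + 1)]→L[ℝ] F) L.symm.toContinuousLinearEquiv
      (fun w => fderiv ℝ (iteratedFDeriv ℝ n (G w)) t)).symm

theorem exists_strongDual_factor {S X : Type*} [AddCommGroup S] [Module 𝕜 S]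
    [NormedAddCommGroup X] [NormedSpace 𝕜 X] (J : S →ₗ[𝕜] X) (f : S →ₗ[𝕜] 𝕜) {C : ℝ}
    (h : ∀ φ, ‖f φ‖ ≤ C * ‖J φ‖) :
    ∃ g : StrongDual 𝕜 X, ∀ φ, g (J φ) = f φ := by
  obtain ⟨σ, hσ⟩ := J.rangeRestrict.exists_rightInverse_of_surjective J.range_rangeRestrict
  have hJσ : ∀ x, J (σ x) = x := fun x => congr_arg Subtype.val (LinearMap.congr_fun hσ x)
  let g₀ : StrongDual 𝕜 (LinearMap.range J) := (f ∘ₗ σ).mkContinuous C fun x => by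
    have hσx := h (σ x)
    rwa [hJσ] at hσx
  obtain ⟨g, hg, -⟩ := exists_extension_norm_eq _ g₀
  refine ⟨g, fun φ => ?_⟩
  have hker := h (σ (J.rangeRestrict φ) - φ)
  rw [map_sub, map_sub, hJσ] at hker
  have hg₀ : g (J φ) = f (σ (J.rangeRestrict φ)) := hg (J.rangeRestrict φ)
  rw [hg₀, ← sub_eq_zero, ← norm_le_zero_iff]
  simpa using hker

theorem apply_integral_of_norm_le {S X Y : Type*} [AddCommGroup S] [Module 𝕜 S]
    [NormedAddCommGroup X] [NormedSpace ℝ X] [NormedSpace 𝕜 X] [CompleteSpace X] (J : S →ₗ[𝕜] X)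
    (f : S →ₗ[𝕜] 𝕜) {C : ℝ} (h : ∀ φ, ‖f φ‖ ≤ C * ‖J φ‖) [MeasurableSpace Y] {ν : Measure Y}
    {G : Y → S} (hint : Integrable (fun w => J (G w)) ν) {Ψ : S}
    (hΨ : J Ψ = ∫ w, J (G w) ∂ν) :
    f Ψ = ∫ w, f (G w) ∂ν := by
  obtain ⟨g, hg⟩ := exists_strongDual_factor J f h
  rw [← hg, hΨ, ← ContinuousLinearMap.integral_comp_comm _ hint]
  simp_rw [hg]

theorem weightedDeriv_integral [CompleteSpace F] (hG : Continuous G)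
    (hint : ∀ k n, Integrable (fun w => SchwartzMap.seminorm ℝ k n (G w)) μ) {Ψ : 𝓢(E, F)}
    (hΨ : ∀ t, Ψ t = ∫ w, G w t ∂μ) (k n : ℕ) :
    Integrable (fun w => weightedDeriv 𝕜 k n (G w)) μ ∧
      weightedDeriv 𝕜 k n Ψ = ∫ w, weightedDeriv 𝕜 k n (G w) ∂μ := by
  have hJ : Integrable (fun w => weightedDeriv 𝕜 k n (G w)) μ :=
    (hint k n).mono' ((weightedDeriv 𝕜 k n).continuous.comp hG).aestronglyMeasurable
      (Eventually.of_forall fun w => (norm_weightedDeriv k n (G w)).le)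
  refine ⟨hJ, ?_⟩
  ext1 t
  rw [← BoundedContinuousFunction.evalCLM_apply 𝕜 t (∫ w, weightedDeriv 𝕜 k n (G w) ∂μ),
    ← ContinuousLinearMap.integral_comp_comm _ hJ]
  simp only [BoundedContinuousFunction.evalCLM_apply, weightedDeriv_apply]
  rw [integral_smul]
  congr 1
  have hΨ' : (Ψ : E → F) = fun t => ∫ w, G w t ∂μ := funext hΨ
  rw [formDeriv, hΨ']
  exact congr_fun (iteratedFDeriv_integral hG (hint 0) n) t

theorem clm_apply_integral_schwartz [CompleteSpace F] (f : 𝓢(E, F) →L[𝕜] 𝕜) (hG : Continuous G)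
    (hint : ∀ k n, Integrable (fun w => SchwartzMap.seminorm ℝ k n (G w)) μ) {Ψ : 𝓢(E, F)}
    (hΨ : ∀ t, Ψ t = ∫ w, G w t ∂μ) :
    f Ψ = ∫ w, f (G w) ∂μ := by
  obtain ⟨s, C, -, hC⟩ := Seminorm.bound_of_continuous (schwartz_withSeminorms 𝕜 E F)
    ((normSeminorm 𝕜 𝕜).comp f.toLinearMap) (continuous_norm.comp f.continuous)
  let J : 𝓢(E, F) →ₗ[𝕜] (i : s) → E →ᵇ MultForm E F i.1.2 :=
    LinearMap.pi fun i => (weightedDeriv 𝕜 i.1.1 i.1.2).toLinearMap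
  have hfJ (φ : 𝓢(E, F)) : ‖f φ‖ ≤ C * ‖J φ‖ := by
    refine (hC φ).trans (mul_le_mul_of_nonneg_left ?_ C.2)
    refine Seminorm.finset_sup_apply_le (norm_nonneg _) fun i hi => ?_
    exact (norm_weightedDeriv i.1 i.2 φ).symm.trans_le (norm_le_pi_norm (J φ) ⟨i, hi⟩)
  have hJ : Integrable (fun w => J (G w)) μ :=
    Integrable.of_eval fun i : s => (weightedDeriv_integral (𝕜 := 𝕜) hG hint hΨ i.1.1 i.1.2).1
  refine apply_integral_of_norm_le J f.toLinearMap hfJ hJ ?_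
  ext1 i
  rw [eval_integral fun i => hJ.eval i]
  exact (weightedDeriv_integral (𝕜 := 𝕜) hG hint hΨ i.1.1 i.1.2).2

end WeakIntegral

section Reproducing

variable {d : ℕ}

theorem continuous_conjSchwartz : Continuous (conjSchwartz : 𝓢(Sp d, ℂ) → 𝓢(Sp d, ℂ)) :=
  (SchwartzMap.postcompCLM (𝕜 := ℝ) (Complex.conjCLE : ℂ →L[ℝ] ℂ)).continuous

theorem conjSchwartz_smul (c : ℂ) (χ : 𝓢(Sp d, ℂ)) :
    conjSchwartz (c • χ) = starRingEnd ℂ c • conjSchwartz χ := by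
  ext t
  simp only [conjSchwartz_apply, smul_apply, smul_eq_mul, map_mul]

theorem continuous_stft (φ : 𝓢(Sp d, ℂ)) (f : 𝓢'(Sp d, ℂ)) : Continuous (stft φ f) :=
  (map_continuous f).comp (continuous_conjSchwartz.comp (continuous_shiftSchwartz φ))

theorem exists_norm_stft_schwartz_le (φ χ : 𝓢(Sp d, ℂ)) (M : ℕ) :
    ∃ C, 0 ≤ C ∧ ∀ w : TF d, ‖stft φ χ w‖ ≤ C * ((1 + ‖w‖) ^ M)⁻¹ := by
  obtain ⟨q, -, hq⟩ := exists_seminorm_stft_schwartz_decay φ M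
  refine ⟨q χ, apply_nonneg _ _, fun w => ?_⟩
  rw [← div_eq_mul_inv, le_div_iff₀ (by positivity), mul_comm]
  exact hq χ w

theorem integrable_stft_schwartz (φ χ : 𝓢(Sp d, ℂ)) : Integrable (stft φ χ) := by
  obtain ⟨C, -, hC⟩ := exists_norm_stft_schwartz_le φ χ (Module.finrank ℝ (TF d) + 1)
  exact ((integrable_inv_one_add_norm_pow volume (Nat.lt_succ_self _)).const_mul C).mono'
    (continuous_stft φ χ).aestronglyMeasurable (Eventually.of_forall hC)

theorem continuous_conjSchwartz_stft_smul_shift (φ χ : 𝓢(Sp d, ℂ)) :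
    Continuous fun w : TF d => conjSchwartz (stft φ χ w • shiftSchwartz w φ) :=
  continuous_conjSchwartz.comp ((continuous_stft φ χ).smul (continuous_shiftSchwartz φ))

theorem integrable_seminorm_conjSchwartz_stft_smul_shift (φ χ : 𝓢(Sp d, ℂ)) (k n : ℕ) :
    Integrable fun w : TF d =>
      SchwartzMap.seminorm ℝ k n (conjSchwartz (stft φ χ w • shiftSchwartz w φ)) := by
  have hp : Continuous (SchwartzMap.seminorm ℝ (E := Sp d) (F := ℂ) k n) :=
    (schwartz_withSeminorms ℝ (Sp d) ℂ).continuous_seminorm (k, n)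
  obtain ⟨m, q, -, hq⟩ := exists_seminorm_shift_le
    ((SchwartzMap.seminorm ℝ (E := Sp d) (F := ℂ) k n).comp
      (SchwartzMap.postcompCLM (𝕜 := ℝ) (Complex.conjCLE : ℂ →L[ℝ] ℂ)).toLinearMap)
    (hp.comp continuous_conjSchwartz)
  let r := Module.finrank ℝ (TF d) + 1
  obtain ⟨C, hC0, hC⟩ := exists_norm_stft_schwartz_le φ χ (m + r)
  refine ((integrable_inv_one_add_norm_pow volume (Nat.lt_succ_self _)).const_mul
    (C * q φ)).mono' (hp.comp (continuous_conjSchwartz_stft_smul_shift φ χ)).aestronglyMeasurable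
    (Eventually.of_forall fun w => ?_)
  have hsmul : SchwartzMap.seminorm ℝ k n (conjSchwartz (stft φ χ w • shiftSchwartz w φ)) =
      ‖stft φ χ w‖ * SchwartzMap.seminorm ℝ k n (conjSchwartz (shiftSchwartz w φ)) := by
    rw [conjSchwartz_smul, ← RCLike.norm_conj (stft φ χ w)]
    exact map_smul_eq_mul (SchwartzMap.seminorm ℂ k n) _ _
  rw [Real.norm_of_nonneg (apply_nonneg _ _), hsmul]
  calc ‖stft φ χ w‖ * SchwartzMap.seminorm ℝ k n (conjSchwartz (shiftSchwartz w φ))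
      ≤ (C * ((1 + ‖w‖) ^ (m + r))⁻¹) * ((1 + ‖w‖) ^ m * q φ) := by
        gcongr
        exacts [hC w, hq w φ]
    _ = C * q φ * ((1 + ‖w‖) ^ r)⁻¹ := by
        rw [pow_add]
        field_simp

theorem integral_prod_L2 {E F G : Type*} [NormedAddCommGroup E] [InnerProductSpace ℝ E]
    [FiniteDimensional ℝ E] [MeasurableSpace E] [BorelSpace E]
    [NormedAddCommGroup F] [InnerProductSpace ℝ F] [FiniteDimensional ℝ F] [MeasurableSpace F]
    [BorelSpace F] [NormedAddCommGroup G] [NormedSpace ℝ G] {f : WithLp 2 (E × F) → G}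
    (hf : Integrable f) :
    ∫ w, f w = ∫ x, ∫ y, f (WithLp.toLp 2 (x, y)) := by
  have hmp := WithLp.volume_preserving_toLp E F
  rw [← hmp.integral_comp (MeasurableEquiv.toLp 2 (E × F)).measurableEmbedding,
    Measure.volume_eq_prod]
  exact integral_prod (fun p : E × F => f (WithLp.toLp 2 p)) (hmp.integrable_comp_of_integrable hf)

theorem stft_schwartz_eq_fourier (φ χ : 𝓢(Sp d, ℂ)) (x ω : Sp d) :
    stft φ χ (WithLp.toLp 2 (x, ω)) =
      𝓕 (SchwartzMap.smulLeftCLM ℂ χ (conjSchwartz (SchwartzMap.compSubConstCLM ℂ x φ))) ω := by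
  rw [stft_schwartz, fourier_eq_integral_tfChar]
  refine integral_congr_ae (Eventually.of_forall fun t => ?_)
  simp only [shiftSchwartz_apply, shiftFun, map_mul, conj_tfChar, conjSchwartz_apply,
    SchwartzMap.smulLeftCLM_apply_apply χ.hasTemperateGrowth, SchwartzMap.compSubConstCLM_apply,
    smul_eq_mul, WithLp.toLp_fst, WithLp.toLp_snd]
  ring

theorem integral_fourier_mul_tfChar (χ : 𝓢(Sp d, ℂ)) (t : Sp d) :
    ∫ ω, 𝓕 χ ω * tfChar ω t = χ t := by
  have hinv : 𝓕⁻ (𝓕 χ) t = χ t := by rw [FourierTransform.fourierInv_fourier_eq]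
  rw [← hinv, SchwartzMap.fourierInv_coe, Real.fourierInv_eq']
  refine integral_congr_ae (Eventually.of_forall fun ω => ?_)
  simp only [tfChar, smul_eq_mul]
  push_cast
  rw [real_inner_comm]
  ring_nf

theorem integral_normSq_ofReal (φ : 𝓢(Sp d, ℂ)) :
    ((∫ t, ‖φ t‖ ^ 2 : ℝ) : ℂ) = ∫ t, starRingEnd ℂ (φ t) * φ t := by
  simp only [← integral_complex_ofReal, RCLike.conj_mul, Complex.ofReal_pow]
  rfl

theorem integral_stft_smul_shift_apply (φ χ : 𝓢(Sp d, ℂ)) (t : Sp d) :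
    ∫ w : TF d, (stft φ χ w • shiftSchwartz w φ) t = ((∫ t, ‖φ t‖ ^ 2 : ℝ) : ℂ) * χ t := by
  have hint : Integrable fun w : TF d => (stft φ χ w • shiftSchwartz w φ) t := by
    refine (integrable_stft_schwartz φ χ).mul_bdd (c := SchwartzMap.seminorm ℝ 0 0 φ)
      (Continuous.aestronglyMeasurable ?_) (Eventually.of_forall fun w => ?_)
    · simp only [shiftSchwartz_apply, shiftFun, tfChar]
      fun_prop
    · rw [norm_shiftSchwartz_apply]
      exact SchwartzMap.norm_le_seminorm ℝ φ _
  have hslice (x : Sp d) :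
      ∫ ω, (stft φ χ (WithLp.toLp 2 (x, ω)) • shiftSchwartz (WithLp.toLp 2 (x, ω)) φ) t =
        starRingEnd ℂ (φ (t - x)) * φ (t - x) * χ t := by
    simp only [smul_apply, smul_eq_mul, shiftSchwartz_apply, shiftFun, stft_schwartz_eq_fourier,
      ← mul_assoc, integral_mul_const, integral_fourier_mul_tfChar, conjSchwartz_apply,
      SchwartzMap.smulLeftCLM_apply_apply χ.hasTemperateGrowth, SchwartzMap.compSubConstCLM_apply,
      WithLp.toLp_fst, WithLp.toLp_snd]
    ring
  simp only [integral_prod_L2 hint, hslice, integral_mul_const]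
  rw [integral_sub_left_eq_self (fun x => starRingEnd ℂ (φ x) * φ x), integral_normSq_ofReal]

theorem integral_stft_mul_conj_stft (φ χ : 𝓢(Sp d, ℂ)) (f : 𝓢'(Sp d, ℂ)) :
    ∫ w : TF d, stft φ f w * starRingEnd ℂ (stft φ χ w) =
      ((∫ t, ‖φ t‖ ^ 2 : ℝ) : ℂ) * f (conjSchwartz χ) := by
  have h : f (((∫ t, ‖φ t‖ ^ 2 : ℝ) : ℂ) • conjSchwartz χ) =
      ∫ w : TF d, f (conjSchwartz (stft φ χ w • shiftSchwartz w φ)) :=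
    clm_apply_integral_schwartz _ (continuous_conjSchwartz_stft_smul_shift φ χ)
      (integrable_seminorm_conjSchwartz_stft_smul_shift φ χ) fun t => by
        simp only [conjSchwartz_apply]
        rw [integral_conj, integral_stft_smul_shift_apply, map_mul, Complex.conj_ofReal]
        rfl
  simpa only [conjSchwartz_smul, map_smul, smul_eq_mul, stft, mul_comm] using h.symm

theorem integral_normSq_pos {φ : 𝓢(Sp d, ℂ)} (hφ : φ ≠ 0) : 0 < ∫ t, ‖φ t‖ ^ 2 := by
  obtain ⟨t, ht⟩ := DFunLike.ne_iff.mp hφ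
  exact integral_pos_of_integrable_nonneg_nonzero (x := t) (φ.continuous.norm.pow 2)
    ((φ.memLp 2).integrable_norm_pow two_ne_zero) (fun t => by positivity)
    (pow_ne_zero 2 (norm_ne_zero_iff.mpr ht))

end Reproducing

section Oscillation

theorem exists_lintegral_ofReal_mul_le {X : Type*} [MeasurableSpace X] {μ : Measure X}
    {g : X → ℝ} (hg : Integrable g μ) {δ : ℝ≥0∞} (hδ : δ ≠ 0) :
    ∃ η : ℝ, 0 < η ∧ ∫⁻ x, ENNReal.ofReal (η * g x) ∂μ ≤ δ := by
  obtain ⟨η, hη, hlt⟩ := ENNReal.exists_nnreal_pos_mul_lt hg.lintegral_lt_top.ne hδ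
  refine ⟨η, hη, le_of_eq_of_le ?_ hlt.le⟩
  simp only [ENNReal.ofReal_mul η.coe_nonneg, ENNReal.ofReal_coe_nnreal]
  exact lintegral_const_mul' _ _ ENNReal.coe_ne_top

variable {d : ℕ}

theorem conjSchwartz_sub (χ ψ : 𝓢(Sp d, ℂ)) :
    conjSchwartz (χ - ψ) = conjSchwartz χ - conjSchwartz ψ :=
  map_sub (SchwartzMap.postcompCLM (𝕜 := ℝ) (Complex.conjCLE : ℂ →L[ℝ] ℂ)) χ ψ

theorem shiftSchwartz_sub (z : TF d) (χ ψ : 𝓢(Sp d, ℂ)) :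
    shiftSchwartz z (χ - ψ) = shiftSchwartz z χ - shiftSchwartz z ψ := by
  simp only [shiftSchwartz, map_sub]

theorem shiftSchwartz_zero (χ : 𝓢(Sp d, ℂ)) : shiftSchwartz 0 χ = χ := by
  ext t
  simp [shiftSchwartz_apply, shiftFun, tfChar]

theorem enorm_apply_conjSchwartz_le (φ χ : 𝓢(Sp d, ℂ)) (f : 𝓢'(Sp d, ℂ)) :
    ENNReal.ofReal (∫ t, ‖φ t‖ ^ 2) * ‖f (conjSchwartz χ)‖ₑ ≤
      ∫⁻ w, ‖stft φ f w‖ₑ * ‖stft φ χ w‖ₑ := by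
  have hE : ENNReal.ofReal (∫ t, ‖φ t‖ ^ 2) = ‖((∫ t, ‖φ t‖ ^ 2 : ℝ) : ℂ)‖ₑ := by
    rw [← ofReal_norm, Complex.norm_of_nonneg (integral_nonneg fun t => sq_nonneg _)]
  rw [hE, ← enorm_mul, ← integral_stft_mul_conj_stft]
  refine (enorm_integral_le_lintegral_enorm _).trans (le_of_eq ?_)
  simp only [enorm_mul, RCLike.enorm_conj]

theorem apply_conjSchwartz_shift_sub (φ : 𝓢(Sp d, ℂ)) (f : 𝓢'(Sp d, ℂ)) (z u : TF d) :
    f (conjSchwartz (shiftSchwartz z (shiftSchwartz u φ - φ))) =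
      tfChar u.snd z.fst * stft φ f (z + u) - stft φ f z := by
  rw [shiftSchwartz_sub, shiftSchwartz_shiftSchwartz, conjSchwartz_sub, conjSchwartz_smul,
    conj_tfChar, neg_neg, map_sub, map_smul, smul_eq_mul, stft, stft]

theorem exists_norm_stft_shift_sub_le (φ : 𝓢(Sp d, ℂ)) (r : ℕ) {η : ℝ} (hη : 0 < η) :
    ∃ ε : ℝ, 0 < ε ∧ ∀ u : TF d, ‖u‖ < ε → ∀ w,
      ‖stft φ (shiftSchwartz u φ - φ : 𝓢(Sp d, ℂ)) w‖ ≤ η * ((1 + ‖w‖) ^ r)⁻¹ := by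
  obtain ⟨q, hq, hdecay⟩ := exists_seminorm_stft_schwartz_decay φ r
  have hlim : Tendsto (fun u : TF d => q (shiftSchwartz u φ - φ)) (𝓝 0) (𝓝 0) := by
    have hcont : Continuous fun u : TF d => q (shiftSchwartz u φ - φ) :=
      hq.comp ((continuous_shiftSchwartz φ).sub continuous_const)
    simpa only [shiftSchwartz_zero, sub_self, map_zero] using hcont.tendsto 0
  obtain ⟨ε, hε, hball⟩ := Metric.eventually_nhds_iff.mp (hlim.eventually_le_const hη)
  refine ⟨ε, hε, fun u hu w => ?_⟩
  rw [← div_eq_mul_inv, le_div_iff₀ (by positivity), mul_comm]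
  exact (hdecay _ w).trans (hball (by rwa [dist_zero_right]))

theorem exists_oscBound {φ : 𝓢(Sp d, ℂ)} (hφ : φ ≠ 0) :
    ∃ ε : ℝ, 0 < ε ∧ ∃ K : TF d → ℝ≥0∞, Measurable K ∧ ∫⁻ y, K y ≤ 2⁻¹ ∧
      ∀ f : 𝓢'(Sp d, ℂ), OscBound volume K ε (fun z => ‖stft φ f z‖ₑ) := by
  let E₀ : ℝ := ∫ t, ‖φ t‖ ^ 2
  have hE₀ : 0 < E₀ := integral_normSq_pos hφ
  let r := Module.finrank ℝ (TF d) + 1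
  obtain ⟨η, hη, hKint⟩ := exists_lintegral_ofReal_mul_le
    (integrable_inv_one_add_norm_pow (volume : Measure (TF d)) (n := r) (Nat.lt_succ_self _))
    (ENNReal.inv_ne_zero.mpr ENNReal.ofNat_ne_top : (2⁻¹ : ℝ≥0∞) ≠ 0)
  let K : TF d → ℝ≥0∞ := fun y => ENNReal.ofReal (η * ((1 + ‖y‖) ^ r)⁻¹)
  obtain ⟨ε, hε, hsmall⟩ := exists_norm_stft_shift_sub_le φ r (mul_pos hE₀ hη)
  refine ⟨ε, hε, K, by fun_prop, hKint, fun f z z' hz => ?_⟩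
  let c := tfChar (z' - z).snd z.fst
  have hbound : ‖c * stft φ f z' - stft φ f z‖ₑ ≤
      (K ⋆ₗ[volume] fun w => ‖stft φ f w‖ₑ) z := by
    have := Measure.IsAddHaarMeasure.isNegInvariant_of_regular (volume : Measure (TF d))
    have hshift := apply_conjSchwartz_shift_sub φ f z (z' - z)
    rw [add_sub_cancel] at hshift
    rw [← hshift, lconvolution_comm, lconvolution_def, ← ENNReal.mul_le_mul_iff_right
      (ENNReal.ofReal_pos.mpr hE₀).ne' ENNReal.ofReal_ne_top]
    refine (enorm_apply_conjSchwartz_le φ _ f).trans ?_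
    rw [← lintegral_const_mul' _ _ ENNReal.ofReal_ne_top]
    refine lintegral_mono fun w => ?_
    rw [mul_left_comm, ← ENNReal.ofReal_mul hE₀.le, ← ofReal_norm (stft φ (shiftSchwartz z _) w),
      norm_stft_schwartz_shift, neg_add_eq_sub, norm_sub_rev z w, ← mul_assoc E₀]
    gcongr
    exact hsmall _ (by rwa [← dist_eq_norm]) _
  have hphase : ‖c * stft φ f z'‖ₑ = ‖stft φ f z'‖ₑ := by
    rw [enorm_mul, ← ofReal_norm (tfChar _ _), norm_tfChar, ENNReal.ofReal_one, one_mul]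
  constructor
  · calc ‖stft φ f z‖ₑ = ‖c * stft φ f z' - (c * stft φ f z' - stft φ f z)‖ₑ := by
          rw [sub_sub_cancel]
      _ ≤ _ := enorm_sub_le.trans (add_le_add hphase.le hbound)
  · calc ‖stft φ f z'‖ₑ = ‖stft φ f z + (c * stft φ f z' - stft φ f z)‖ₑ := by
          rw [add_sub_cancel, hphase]
      _ ≤ _ := (enorm_add_le _ _).trans (by gcongr)

end Oscillation

section Moyal

variable {d : ℕ}

theorem eLpNorm_two_eq_sqrt {α E : Type*} [MeasurableSpace α] [NormedAddCommGroup E]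
    {μ : Measure α} {F : α → E} (hF : MemLp F 2 μ) :
    eLpNorm F 2 μ = ENNReal.ofReal (√(∫ x, ‖F x‖ ^ 2 ∂μ)) := by
  rw [hF.eLpNorm_eq_integral_rpow_norm two_ne_zero ENNReal.ofNat_ne_top, Real.sqrt_eq_rpow]
  simp

theorem memLp_two_stft_schwartz (φ χ : 𝓢(Sp d, ℂ)) : MemLp (stft φ χ) 2 volume := by
  have hmeas := (continuous_stft φ χ).aestronglyMeasurable (μ := volume)
  obtain ⟨C, -, hC⟩ := exists_norm_stft_schwartz_le φ χ 0
  rw [memLp_two_iff_integrable_sq_norm hmeas]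
  simp_rw [pow_two]
  refine (integrable_stft_schwartz φ χ).norm.mul_bdd (c := C) hmeas.norm
    (Eventually.of_forall fun w => ?_)
  simpa using hC w

theorem eLpNorm_stft_schwartz (φ χ : 𝓢(Sp d, ℂ)) :
    eLpNorm (stft φ χ) 2 volume =
      ENNReal.ofReal (√(∫ t, ‖φ t‖ ^ 2)) * ‖(χ.toLp 2 : L2 d)‖ₑ := by
  have hχ : (χ : 𝓢'(Sp d, ℂ)) (conjSchwartz χ) = ((∫ t, ‖χ t‖ ^ 2 : ℝ) : ℂ) := by
    rw [SchwartzMap.coe_apply, integral_normSq_ofReal]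
    rfl
  have hstft : ∫ w, stft φ χ w * starRingEnd ℂ (stft φ χ w) =
      ((∫ w, ‖stft φ χ w‖ ^ 2 : ℝ) : ℂ) := by
    simp_rw [Complex.mul_conj, Complex.normSq_eq_norm_sq]
    exact integral_complex_ofReal
  have key := integral_stft_mul_conj_stft φ χ χ
  rw [hχ, hstft] at key
  have key' : ∫ w, ‖stft φ χ w‖ ^ 2 = (∫ t, ‖φ t‖ ^ 2) * ∫ t, ‖χ t‖ ^ 2 := by
    exact_mod_cast key
  rw [SchwartzMap.toLp, Lp.enorm_toLp, eLpNorm_two_eq_sqrt (χ.memLp 2 volume),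
    eLpNorm_two_eq_sqrt (memLp_two_stft_schwartz φ χ), key',
    Real.sqrt_mul (integral_nonneg fun t => by positivity),
    ENNReal.ofReal_mul (Real.sqrt_nonneg _)]

theorem stft_sub (φ : 𝓢(Sp d, ℂ)) (f g : 𝓢'(Sp d, ℂ)) :
    stft φ (f - g) = stft φ f - stft φ g :=
  rfl

theorem toTemperedDistribution_sub (f g : L2 d) :
    ((f - g : L2 d) : 𝓢'(Sp d, ℂ)) = (f : 𝓢'(Sp d, ℂ)) - (g : 𝓢'(Sp d, ℂ)) :=
  map_sub (Lp.toTemperedDistributionCLM ℂ (volume : Measure (Sp d)) 2) f g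

theorem continuous_stft_L2 (φ : 𝓢(Sp d, ℂ)) (w : TF d) :
    Continuous fun f : L2 d => stft φ (f : 𝓢'(Sp d, ℂ)) w :=
  (continuous_eval_const (conjSchwartz (shiftSchwartz w φ))).comp
    (Lp.toTemperedDistributionCLM ℂ (volume : Measure (Sp d)) 2).continuous

theorem exists_seq_tendsto_toLp (f : L2 d) :
    ∃ χ : ℕ → 𝓢(Sp d, ℂ), Tendsto (fun n => (χ n).toLp 2) atTop (𝓝 f) := by
  have hdense := SchwartzMap.denseRange_toLpCLM (E := Sp d) (F := ℂ) (p := 2) (μ := volume)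
    ENNReal.ofNat_ne_top
  obtain ⟨u, hu, hlim⟩ := mem_closure_iff_seq_limit.mp (hdense f)
  choose χ hχ using hu
  exact ⟨χ, by rwa [← funext hχ] at hlim⟩

theorem tendsto_ofReal_mul_enorm {ι E : Type*} [NormedAddCommGroup E] {l : Filter ι} {u : ι → E}
    {f : E} (c : ℝ) (h : Tendsto u l (𝓝 f)) :
    Tendsto (fun n => ENNReal.ofReal c * ‖u n‖ₑ) l (𝓝 (ENNReal.ofReal c * ‖f‖ₑ)) :=
  ENNReal.Tendsto.const_mul h.enorm (Or.inr ENNReal.ofReal_ne_top)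

theorem eLpNorm_stft_L2_le (φ : 𝓢(Sp d, ℂ)) (f : L2 d) :
    eLpNorm (stft φ (f : 𝓢'(Sp d, ℂ))) 2 volume ≤
      ENNReal.ofReal (√(∫ t, ‖φ t‖ ^ 2)) * ‖f‖ₑ := by
  obtain ⟨χ, hχ⟩ := exists_seq_tendsto_toLp f
  refine (Lp.eLpNorm_lim_le_liminf_eLpNorm
    (f := fun n => stft φ ((χ n).toLp 2 : L2 d))
    (fun n => (continuous_stft φ _).aestronglyMeasurable) _
    (Eventually.of_forall fun w => by
      exact ((continuous_stft_L2 φ w).tendsto f).comp hχ)).trans ?_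
  simp_rw [Lp.toTemperedDistribution_toLp_eq, eLpNorm_stft_schwartz]
  exact (tendsto_ofReal_mul_enorm _ hχ).liminf_eq.le

theorem eLpNorm_stft_L2 (φ : 𝓢(Sp d, ℂ)) (f : L2 d) :
    eLpNorm (stft φ (f : 𝓢'(Sp d, ℂ))) 2 volume =
      ENNReal.ofReal (√(∫ t, ‖φ t‖ ^ 2)) * ‖f‖ₑ := by
  refine le_antisymm (eLpNorm_stft_L2_le φ f) ?_
  obtain ⟨χ, hχ⟩ := exists_seq_tendsto_toLp f
  have herr : Tendsto (fun n => eLpNorm (stft φ (f : 𝓢'(Sp d, ℂ))) 2 volume +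
      ENNReal.ofReal (√(∫ t, ‖φ t‖ ^ 2)) * ‖(χ n).toLp 2 volume - f‖ₑ) atTop
      (𝓝 (eLpNorm (stft φ (f : 𝓢'(Sp d, ℂ))) 2 volume)) := by
    simpa using tendsto_const_nhds.add
      (tendsto_ofReal_mul_enorm (√(∫ t, ‖φ t‖ ^ 2)) (hχ.sub_const f))
  refine le_of_tendsto_of_tendsto' (tendsto_ofReal_mul_enorm _ hχ) herr fun n => ?_
  calc ENNReal.ofReal (√(∫ t, ‖φ t‖ ^ 2)) * ‖(χ n).toLp 2 volume‖ₑ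
      = eLpNorm (stft φ (f : 𝓢'(Sp d, ℂ)) + stft φ ((χ n).toLp 2 volume - f : L2 d)) 2 volume := by
        rw [toTemperedDistribution_sub, stft_sub, add_sub_cancel,
          Lp.toTemperedDistribution_toLp_eq, eLpNorm_stft_schwartz]
    _ ≤ eLpNorm (stft φ (f : 𝓢'(Sp d, ℂ))) 2 volume +
          eLpNorm (stft φ ((χ n).toLp 2 volume - f : L2 d)) 2 volume :=
        eLpNorm_add_le (continuous_stft φ _).aestronglyMeasurable
          (continuous_stft φ _).aestronglyMeasurable one_le_two
    _ ≤ _ := by gcongr; exact eLpNorm_stft_L2_le φ _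

end Moyal

section Gabor

variable {d : ℕ}

theorem shiftL2_toLp (z : TF d) (χ : 𝓢(Sp d, ℂ)) :
    shiftL2 z (χ.toLp 2) = (shiftSchwartz z χ).toLp 2 := by
  refine Lp.ext ?_
  have htranslate : (fun t => χ.toLp 2 volume (t - z.fst)) =ᵐ[volume] fun t => χ (t - z.fst) :=
    (measurePreserving_sub_right volume z.fst).quasiMeasurePreserving.ae_eq_comp
      (χ.coeFn_toLp 2 volume)
  filter_upwards [MemLp.coeFn_toLp (memLp_shiftFun z (Lp.memLp (χ.toLp 2))), htranslate,
    (shiftSchwartz z χ).coeFn_toLp 2 volume] with t hshift ht hχ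
  rw [hχ, shiftSchwartz_apply, shiftL2, hshift, shiftFun, shiftFun, ht]

theorem gaborSystem_toLp {N : ℕ} (φ : 𝓢(Sp d, ℂ)) (ζ : Fin N → TF d) (T : Set (TF d)) :
    gaborSystem (fun i => shiftL2 (ζ i) (φ.toLp 2)) T =
      fun j : Fin N × T => (shiftSchwartz (j.2 : TF d) (shiftSchwartz (ζ j.1) φ)).toLp 2 := by
  ext1 j
  rw [gaborSystem, shiftL2_toLp, shiftL2_toLp]

theorem pairM_toLp {φ : 𝓢(Sp d, ℂ)} (hφ : φ ≠ 0) (f : 𝓢'(Sp d, ℂ)) (χ : 𝓢(Sp d, ℂ)) :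
    pairM φ f (χ.toLp 2 : L2 d) = f (conjSchwartz χ) := by
  have hφ' : ((∫ t, ‖φ t‖ ^ 2 : ℝ) : ℂ) ≠ 0 := by exact_mod_cast (integral_normSq_pos hφ).ne'
  rw [pairM, Lp.toTemperedDistribution_toLp_eq, integral_stft_mul_conj_stft,
    inv_mul_cancel_left₀ hφ']

theorem inner_toLp (χ : 𝓢(Sp d, ℂ)) (f : L2 d) :
    ⟪χ.toLp 2, f⟫_ℂ = (f : 𝓢'(Sp d, ℂ)) (conjSchwartz χ) := by
  rw [L2.inner_def, Lp.toTemperedDistribution_apply]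
  refine integral_congr_ae ?_
  filter_upwards [χ.coeFn_toLp 2 volume] with t ht
  rw [ht, RCLike.inner_apply, conjSchwartz_apply, smul_eq_mul, mul_comm]

theorem memM_one_toLp (φ χ : 𝓢(Sp d, ℂ)) : MemM φ 1 (χ.toLp 2 : L2 d) := by
  rw [MemM, Lp.toTemperedDistribution_toLp_eq, memLp_one_iff_integrable]
  exact integrable_stft_schwartz φ χ

theorem enorm_pairM_gaborSystem {φ : 𝓢(Sp d, ℂ)} (hφ : φ ≠ 0) (f : 𝓢'(Sp d, ℂ)) {N : ℕ}
    (ζ : Fin N → TF d) (T : Set (TF d)) (j : Fin N × T) :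
    ‖pairM φ f (gaborSystem (fun i => shiftL2 (ζ i) (φ.toLp 2)) T j)‖ₑ =
      ‖stft φ f (j.2 + ζ j.1)‖ₑ := by
  rw [gaborSystem_toLp, pairM_toLp hφ, shiftSchwartz_shiftSchwartz, conjSchwartz_smul, map_smul,
    enorm_smul, RCLike.enorm_conj, ← ofReal_norm, norm_tfChar, ENNReal.ofReal_one, one_mul, stft]

theorem isMFrame_of_eLpNorm_le {J : Type*} [MeasurableSpace J] [MeasurableSingletonClass J]
    {φ : 𝓢(Sp d, ℂ)} {p : ℝ≥0∞} (hp : 1 ≤ p) {e : J → L2 d} {A B : ℝ≥0∞} (hA : A ≠ ∞)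
    (hB : B ≠ ∞)
    (hlow : ∀ f, MemM φ p f →
      eLpNorm (stft φ f) p volume ≤ A * eLpNorm (fun j => pairM φ f (e j)) p .count)
    (hup : ∀ f, MemM φ p f →
      eLpNorm (fun j => pairM φ f (e j)) p .count ≤ B * eLpNorm (stft φ f) p volume) :
    IsMFrame φ p e := by
  refine ⟨(A.toReal + 1)⁻¹, B.toReal + 1, by positivity, by positivity, fun f hf => ?_⟩
  have hfin : eLpNorm (fun j => pairM φ f (e j)) p .count ≠ ∞ :=
    ne_top_of_le_ne_top (ENNReal.mul_ne_top hB hf.eLpNorm_ne_top) (hup f hf)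
  obtain ⟨c, hc, hnorm⟩ := exists_lp_norm_eq_eLpNorm_count hp hfin
  have : Fact (1 ≤ p) := ⟨hp⟩
  refine ⟨c, congr_fun hc, ?_, ?_⟩
  · rw [inv_mul_le_iff₀ (by positivity)]
    calc normM φ p f ≤ A.toReal * ‖c‖ := by
          rw [hnorm, ← ENNReal.toReal_mul]
          exact ENNReal.toReal_mono (ENNReal.mul_ne_top hA hfin) (hlow f hf)
      _ ≤ (A.toReal + 1) * ‖c‖ := by gcongr; linarith
  · calc ‖c‖ ≤ B.toReal * normM φ p f := by
          rw [hnorm, normM, ← ENNReal.toReal_mul]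
          exact ENNReal.toReal_mono (ENNReal.mul_ne_top hB hf.eLpNorm_ne_top) (hup f hf)
      _ ≤ (B.toReal + 1) * normM φ p f := by
          gcongr
          · exact ENNReal.toReal_nonneg
          · linarith

theorem isMFrame_gaborSystem {φ : 𝓢(Sp d, ℂ)} (hφ : φ ≠ 0) {ε : ℝ} {k : TF d → ℝ≥0∞}
    (hk : Measurable k) (hk2 : ∫⁻ y, k y ≤ 2⁻¹)
    (hosc : ∀ f : 𝓢'(Sp d, ℂ), OscBound volume k ε fun z => ‖stft φ f z‖ₑ) {N : ℕ}
    (ζ : Fin N → TF d) {T : Set (TF d)} (hT : IsDelone T)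
    (hdense : ∀ z : TF d, ∃ j : Fin N × T, dist z (j.2 + ζ j.1) < ε) {p : ℝ≥0∞} (hp : 1 ≤ p) :
    IsMFrame φ p (gaborSystem (fun i => shiftL2 (ζ i) (φ.toLp 2)) T) := by
  have := Measure.IsAddHaarMeasure.isNegInvariant_of_regular (volume : Measure (TF d))
  have : Countable T := (countable_of_isDelone hT).to_subtype
  have hε : 0 < ε := dist_nonneg.trans_lt (hdense 0).choose_spec
  obtain ⟨r, hr, hencard⟩ := exists_encard_mem_ball_add_le hT
  have hoverlap : ∀ z : TF d,
      {j : Fin N × T | z ∈ Metric.ball (j.2 + ζ j.1) (min ε r)}.encard ≤ N := fun z => by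
    refine le_trans (encard_le_encard fun j hj => ?_) (hencard ζ z)
    exact Metric.ball_subset_ball (min_le_right ε r) hj
  have hmeas : ∀ f : 𝓢'(Sp d, ℂ), Measurable fun z => ‖stft φ f z‖ₑ := fun f =>
    (continuous_stft φ f).enorm.measurable
  have hcoeff : ∀ f : 𝓢'(Sp d, ℂ),
      eLpNorm (fun j => pairM φ f (gaborSystem (fun i => shiftL2 (ζ i) (φ.toLp 2)) T j)) p .count =
        eLpNorm ((fun z => ‖stft φ f z‖ₑ) ∘ fun j : Fin N × T => j.2 + ζ j.1) p .count := fun f =>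
    eLpNorm_congr_enorm_ae (.of_forall fun j => enorm_pairM_gaborSystem hφ f ζ T j)
  have hball : ∀ s : ℝ, volume (Metric.ball (0 : TF d) s) ^ (1 / p.toReal) ≠ ∞ := fun s =>
    ENNReal.rpow_ne_top_of_nonneg (by positivity) measure_ball_lt_top.ne
  have hball' : (volume (Metric.ball (0 : TF d) (min ε r)) ^ (1 / p.toReal))⁻¹ ≠ ∞ :=
    ENNReal.inv_ne_top.mpr (ENNReal.rpow_pos
      (Metric.measure_ball_pos _ _ (lt_min hε hr)) measure_ball_lt_top.ne).ne'
  have hN : (N : ℝ≥0∞) ^ (1 / p.toReal) ≠ ∞ :=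
    ENNReal.rpow_ne_top_of_nonneg (by positivity) (ENNReal.natCast_ne_top N)
  have htwo : (2 : ℝ≥0∞) ≠ ∞ := ENNReal.ofNat_ne_top
  refine isMFrame_of_eLpNorm_le hp (ENNReal.mul_ne_top htwo (hball ε))
    (ENNReal.mul_ne_top hball' (ENNReal.mul_ne_top hN htwo)) (fun f hf => ?_) (fun f _ => ?_) <;>
    rw [hcoeff, ← eLpNorm_enorm (stft φ f)]
  · exact eLpNorm_le_eLpNorm_samples hk hk2 (hmeas f) (hosc f) hdense hp
      (by rw [eLpNorm_enorm]; exact hf.eLpNorm_ne_top)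
  · exact eLpNorm_samples_le_eLpNorm hk hk2 (hmeas f) ((hosc f).mono (min_le_left ε r))
      (lt_min hε hr) hoverlap hp

theorem isFrame_of_isMFrame_two {φ : 𝓢(Sp d, ℂ)} (hφ : φ ≠ 0) {J : Type*} {χ : J → 𝓢(Sp d, ℂ)}
    (h : IsMFrame φ 2 fun j => (χ j).toLp 2) : IsFrame fun j => (χ j).toLp 2 volume := by
  obtain ⟨A, B, hA, hB, hAB⟩ := h
  have hφ2 : 0 < ∫ t, ‖φ t‖ ^ 2 := integral_normSq_pos hφ
  refine ⟨A ^ 2 * ∫ t, ‖φ t‖ ^ 2, B ^ 2 * ∫ t, ‖φ t‖ ^ 2, by positivity, by positivity,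
    fun f => ?_⟩
  have hmem : MemM φ 2 (f : 𝓢'(Sp d, ℂ)) := by
    refine ⟨(continuous_stft φ _).aestronglyMeasurable, ?_⟩
    rw [eLpNorm_stft_L2]
    exact ENNReal.mul_lt_top ENNReal.ofReal_lt_top enorm_lt_top
  have hnorm : normM φ 2 (f : 𝓢'(Sp d, ℂ)) = √(∫ t, ‖φ t‖ ^ 2) * ‖f‖ := by
    rw [normM, eLpNorm_stft_L2, ENNReal.toReal_mul, ENNReal.toReal_ofReal (by positivity),
      toReal_enorm]
  have hsq : ∀ C : ℝ, C ^ 2 * (∫ t, ‖φ t‖ ^ 2) * ‖f‖ ^ 2 = (C * normM φ 2 f) ^ 2 := fun C => by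
    rw [hnorm, mul_pow, mul_pow, Real.sq_sqrt hφ2.le, mul_assoc]
  obtain ⟨c, hc, hlow, hup⟩ := hAB f hmem
  have hinner : ∀ j, ‖⟪(χ j).toLp 2 volume, f⟫_ℂ‖ ^ 2 = ‖c j‖ ^ (2 : ℝ≥0∞).toReal := fun j => by
    rw [hc, pairM_toLp hφ, inner_toLp, ENNReal.toReal_ofNat, Real.rpow_ofNat]
  have hsum : ∑' j, ‖c j‖ ^ (2 : ℝ≥0∞).toReal = ‖c‖ ^ 2 := by
    have := lp.norm_rpow_eq_tsum (p := 2) (by norm_num) c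
    rw [← this, ENNReal.toReal_ofNat, Real.rpow_ofNat]
  simp only [hinner, hsum, hsq]
  have hM : 0 ≤ normM φ 2 f := ENNReal.toReal_nonneg
  refine ⟨(lp.memℓp c).summable (by norm_num), ?_, ?_⟩ <;> gcongr

end Gabor

end GaborQC

end

open GaborQC NNReal in
theorem theorem1p3_general (d : ℕ) {ρ : ℝ≥0} {Λ : Set (TF d)} (hΛ : Metric.IsCover ρ univ Λ)
    (φ : 𝓢(Sp d, ℂ)) (hφ : φ ≠ 0) :
    ∃ g : L2 d, MemM φ 1 (g : 𝓢'(Sp d, ℂ)) ∧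
      ∃ (N : ℕ) (ζ : Fin N → TF d), ∀ T ∈ hull Λ,
        IsFrame (gaborSystem (fun i => shiftL2 (ζ i) g) T) ∧
        ∀ p : ℝ≥0∞, 1 ≤ p → IsMFrame φ p (gaborSystem (fun i => shiftL2 (ζ i) g) T) := by
  obtain ⟨ε, hε, k, hk, hk2, hosc⟩ := exists_oscBound hφ
  obtain ⟨N, ζ, hζ⟩ := exists_finite_translates_dense (V := TF d) ρ hε
  refine ⟨φ.toLp 2 volume, memM_one_toLp φ φ, N, ζ, fun T hT => ?_⟩
  have hM : ∀ p : ℝ≥0∞, 1 ≤ p →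
      IsMFrame φ p (gaborSystem (fun i => shiftL2 (ζ i) (φ.toLp 2 volume)) T) := fun p hp =>
    isMFrame_gaborSystem hφ hk hk2 hosc ζ hT.1 (hζ T (isCover_of_mem_hull hΛ hT)) hp
  refine ⟨?_, hM⟩
  have hM2 := hM 2 one_le_two
  rw [gaborSystem_toLp] at hM2 ⊢
  exact isFrame_of_isMFrame_two hφ hM2

theorem theorem1p3 (d : ℕ) (Λ : Set (GaborQC.TF d)) (hΛ : GaborQC.IsQuasicrystal Λ)
    (φ : 𝓢(GaborQC.Sp d, ℂ)) (hφ : φ ≠ 0) :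
    ∃ g : GaborQC.L2 d, GaborQC.MemM φ 1 (g : 𝓢'(GaborQC.Sp d, ℂ)) ∧
      ∃ (N : ℕ) (ζ : Fin N → GaborQC.TF d),
        ∀ T ∈ GaborQC.hull Λ,
          GaborQC.IsFrame (GaborQC.gaborSystem (fun i => GaborQC.shiftL2 (ζ i) g) T) ∧
          ∀ p : ℝ≥0∞, 1 ≤ p →
            GaborQC.IsMFrame φ p
              (GaborQC.gaborSystem (fun i => GaborQC.shiftL2 (ζ i) g) T) := by
  obtain ⟨D, rfl⟩ := hΛ.delone
  exact theorem1p3_general d D.isCover_coveringRadius φ hφ
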